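/- **Setting.** Let $\{G_1,\dots,G_m\}$ be nondeterministic automata with alphabets $\Sigma_i$, an unobservable event $\tau$, and secret state sets $Q_i^S\subseteq Q_i$. Let $G=G_1\|\cdots\|G_m$ be their synchronous composition, with alphabet $\Sigma=\bigcup_i\Sigma_i$, secret states $Q^S=\{(x_1,\dots,x_m)\mid \exists i:\ x_i\in Q_i^S\}$, and language $L(G)$ of observable strings. The observer $det(H)$ of an automaton $H$ is the accessible part of its subset automaton (with $\tau$-closures and nonempty estimates). The desired observer $det_d(H)$ is the accessible part of what remains of $det(H)$ after removing the estimates that consist of secret states only. **Three-player observers.** The largest three-player observer (TPO) w.r.t. a desired observer $D$ and an observer $F$ has initial state $(d_0,f_0)$, $Y$-states $(d,f)$, $Z$-states $(d,f,e)$ and $W$-states $(d,f,e)$, $(d,f,e\to\epsilon)$, where $d,f$ are states of $D,F$ and $e$ is an event. Its transitions are all of the following: - $(d,f)\xrightarrow{e}(d,f,e)_Z$ if $f\xrightarrow{e}$; - $(d,f,e)_Z\xrightarrow{\theta}(d',f,e)_Z$ if $d\xrightarrow{\theta}d'$ (insertion of $\theta$); - $(d,f,e)_Z\xrightarrow{\epsilon}(d,f,e)_W$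 if $d\xrightarrow{e}$ and $f\xrightarrow{e}$; - $(d,f,e)_Z\xrightarrow{e\to\epsilon}(d,f,e\to\epsilon)_W$ if $f\xrightarrow{e}$ (erasure of $e$); - $(d,f,e)_W\xrightarrow{e}(d',f')$ if $d\xrightarrow{e}d'$ and $f\xrightarrow{e}f'$; - $(d,f,e\to\epsilon)_W\xrightarrow{e}(d,f')$ if $f\xrightarrow{e}f'$. A run $\omega$ is a (possibly empty) path from the initial state to a $Y$-state; it is determined by its label string. It consists of rounds $e\,\theta^1\cdots\theta^{k-1}\theta^{k}\,e$ with inserted events $\theta^1,\dots,\theta^{k-1}$ and $\theta^k\in\{\epsilon,\,e\to\epsilon\}$. The edit projection $P_e(\omega)$ is the string of the events $e$ of its rounds, and $l(\omega)$ is the concatenation of the strings $\theta^1\cdots\theta^{k-1}e$ (if $\theta^k=\epsilon$) or $\theta^1\cdots\theta^{k-1}$ (if $\theta^k=e\to\epsilon$). An edit function is a map $f_e:\Sigma^*\times\Sigma\to\Sigma^*$, extended to strings by $f_e(\varepsilon)=\varepsilon$ and $f_e(s\sigma)=f_e(s)f_e(s,\sigma)$. It is embedded in a TPO if for every $s\in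 L(G)$ there is a run $\omega$ with $P_e(\omega)=s$ and $l(\omega)=f_e(s)$. **Constraint and All Edit Structure.** Fix $n\in\mathbb N$. The edit constraint $\Phi$ says that among the edit decisions (the labels of transitions from $Z$-states) there are no $n+1$ consecutive erasures; insertions and $\epsilon$ interrupt a sequence of erasures. The All Edit Structure $AES$ of the system is the largest complete substructure of the largest TPO w.r.t. $det_d(G)$ and $det(G)$ that satisfies $\Phi$. Here a state also records the current number of consecutive erasures. Complete means that no $Z$- or $W$-state deadlocks, that no event enabled in $det(G)$ is disabled at a $Y$-state, and that every $s\in L(G)$ is $P_e(\omega)$ for some run $\omega$. **Algorithm CA-AES.** For each $i$ let: - $\sim_o$ be an opaque observation equivalence on $G_i$, i.e. an equivalence relation such that equivalent states are both secret or both non-secret and can match each other's weak transitions $\Rightarrow^s$, $s\in\Sigma_i^*$, up to equivalence; and $\tilde G_i=G_i/{\sim_o}$; - $H_{i,ob}$ be the quotient of $det(\tilde G_i)$ by an opaque bisimulation, i.e. a bisimulation that relates no estimate consisting of secret states only to one that does not; - $H_{i,b}$ be the quotient of $det(\tilde G_i)$ by a bisimulation; - $H_{i,obd}$ be the desired observer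 of $H_{i,ob}$, and $T'_i$ the largest TPO w.r.t. $H_{i,obd}$ and $H_{i,b}$. The automaton $G_i^T$ is obtained from $T'_i$ as follows. Labels $e$ from $Y$-states are kept. Labels $\theta$ from $Z$-states with event $e$ become $\theta_e$. Labels $e$ from $W$-states with action $a$ become $e_{a,w}$. The $Y$-states are marked. Every event $\alpha\in\Sigma_j\setminus\Sigma_i$, $j\ne i$, is added as a self-loop at every $Y$-state. For such $\alpha$ and $\sigma\in\Sigma_i\cap\Sigma_j$, the events $\sigma_\alpha,\sigma_{\alpha,w},\sigma_{\alpha\to\epsilon,w}$ are added to the alphabet. Only the events $\theta_e$ are controllable. The renaming $\rho$ removes the subscripts. The specification $K$ has states $x_1,\dots,x_{n+2}$, of which $x_1$ is initial and all but $x_{n+2}$ are marked. From each $x_i$ with $i\le n+1$, every erasure $(\alpha\to\epsilon)_\alpha$ leads to $x_{i+1}$, and every $\epsilon_\alpha$ and every insertion $\alpha_\sigma$ leads to $x_1$; $x_{n+2}$ has no outgoing transitions. Let $\mathcal S$ be the least restrictive controllable and nonblocking supervisor of $\{G_1^T,\dots,G_m^T,K\}$, i.e. the largest accessible, controllable and nonblocking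 subautomaton of $G_1^T\|\cdots\|G_m^T\|K$. **Theorem (soundness of Algorithm CA-AES).** 1. For every string $t$ of $\mathcal S$ that ends in a marked state, $\rho(t)$ is the label string of a sequence of rounds. 2. For every $t\in L(\mathcal S)$ such that $\rho(t)$ is the label string of a sequence of rounds $\omega$: $\omega$ is a run of $AES$, $s:=P_e(\rho(t))\in L(G)$, and there is an edit function $f_e$ embedded in $AES$ with $l(\rho(t))=f_e(s)$. 3. Every edit function $f_e$ such that for all $s\in L(G)$ there is $t\in L(\mathcal S)$ with $P_e(\rho(t))=s$ and $l(\rho(t))=f_e(s)$ is embedded in $AES$. -/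

import Mathlib

/-! ### Automata -/

/-- A (nondeterministic) automaton with observable events in `E` and states in the carrier set
`states` of an ambient type `Q`. The label `none` is the unobservable event `τ`; it is never in
the alphabet. The field `marked` is only relevant for supervisory control. -/
@[ext]
structure Automaton (E : Type*) (Q : Type*) where
  alphabet : Set E
  states : Set Q
  step : Q → Option E → Q → Prop
  init : Set Q
  marked : Set Q
  step_left : ∀ {x l y}, step x l y → x ∈ states
  step_right : ∀ {x l y}, step x l y → y ∈ states
  step_event : ∀ {x e y}, step x (some e) y → e ∈ alphabet
  init_sub : init ⊆ states
  marked_sub : marked ⊆ states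

namespace Automaton

variable {E Q : Type*}

/-- `x →^t y` for a string `t` that may contain `τ`. -/
inductive Path (G : Automaton E Q) : Q → List (Option E) → Q → Prop
  | nil (x : Q) : Path G x [] x
  | cons {x y z : Q} {l : Option E} {t : List (Option E)} :
      G.step x l y → Path G y t z → Path G x (l :: t) z

/-- `x ⇒^s y`: a path whose observable part is `s` (`List.reduceOption` erases every `τ`). -/
def WPath (G : Automaton E Q) (x : Q) (s : List E) (y : Q) : Prop :=
  ∃ t : List (Option E), t.reduceOption = s ∧ G.Path x t y

def Reachable (G : Automaton E Q) (x : Q) : Prop :=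
  ∃ x₀ ∈ G.init, ∃ t, G.Path x₀ t x

def Coreachable (G : Automaton E Q) (x : Q) : Prop :=
  ∃ y ∈ G.marked, ∃ t, G.Path x t y

/-- The language of an automaton. -/
def lang (G : Automaton E Q) : Set (List E) :=
  {s | ∃ x₀ ∈ G.init, ∃ y, G.WPath x₀ s y}

/-- The marked language: strings that may end in a marked state. -/
def markedLang (G : Automaton E Q) : Set (List E) :=
  {s | ∃ x₀ ∈ G.init, ∃ y ∈ G.marked, G.WPath x₀ s y}

/-- The subautomaton relation. -/
structure Sub (A B : Automaton E Q) : Prop where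
  alphabet : A.alphabet = B.alphabet
  states : A.states ⊆ B.states
  step : ∀ x l y, A.step x l y → B.step x l y
  init : A.init ⊆ B.init
  marked : A.marked ⊆ B.marked

/-- The accessible part. -/
def acc (G : Automaton E Q) : Automaton E Q where
  alphabet := G.alphabet
  states := {x | x ∈ G.states ∧ G.Reachable x}
  step x l y := G.step x l y ∧ G.Reachable x ∧ G.Reachable y
  init := G.init
  marked := {x | x ∈ G.marked ∧ G.Reachable x}
  step_left h := ⟨G.step_left h.1, h.2.1⟩
  step_right h := ⟨G.step_right h.1, h.2.2⟩
  step_event h := G.step_event h.1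
  init_sub _ hx := ⟨G.init_sub hx, _, hx, [], Path.nil _⟩
  marked_sub _ hx := ⟨G.marked_sub hx.1, hx.2⟩

/-- Removal of the states in `V`, together with all their transitions. -/
def remove (G : Automaton E Q) (V : Set Q) : Automaton E Q where
  alphabet := G.alphabet
  states := G.states \ V
  step x l y := G.step x l y ∧ x ∉ V ∧ y ∉ V
  init := G.init \ V
  marked := G.marked \ V
  step_left h := ⟨G.step_left h.1, h.2.1⟩
  step_right h := ⟨G.step_right h.1, h.2.2⟩
  step_event h := G.step_event h.1
  init_sub _ hx := ⟨G.init_sub hx.1, hx.2⟩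
  marked_sub _ hx := ⟨G.marked_sub hx.1, hx.2⟩

/-- The quotient automaton modulo an equivalence relation. -/
def quot (G : Automaton E Q) (r : Setoid Q) : Automaton E (Quotient r) where
  alphabet := G.alphabet
  states := Quotient.mk r '' G.states
  step c l d := ∃ x y, G.step x l y ∧ Quotient.mk r x = c ∧ Quotient.mk r y = d
  init := Quotient.mk r '' G.init
  marked := Quotient.mk r '' G.marked
  step_left := by rintro _ _ _ ⟨x, y, h, rfl, rfl⟩; exact ⟨x, G.step_left h, rfl⟩
  step_right := by rintro _ _ _ ⟨x, y, h, rfl, rfl⟩; exact ⟨y, G.step_right h, rfl⟩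
  step_event := by rintro _ _ _ ⟨x, y, h, rfl, rfl⟩; exact G.step_event h
  init_sub := Set.image_mono G.init_sub
  marked_sub := Set.image_mono G.marked_sub

/-- Synchronous composition of two automata. -/
def sync {Q' : Type*} (G : Automaton E Q) (H : Automaton E Q') : Automaton E (Q × Q') where
  alphabet := G.alphabet ∪ H.alphabet
  states := G.states ×ˢ H.states
  step x l y := x ∈ G.states ×ˢ H.states ∧
    ((∃ e, l = some e ∧ e ∈ G.alphabet ∩ H.alphabet ∧ G.step x.1 l y.1 ∧ H.step x.2 l y.2) ∨
     ((l = none ∨ ∃ e, l = some e ∧ e ∈ G.alphabet \ H.alphabet) ∧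
        G.step x.1 l y.1 ∧ y.2 = x.2) ∨
     ((l = none ∨ ∃ e, l = some e ∧ e ∈ H.alphabet \ G.alphabet) ∧
        y.1 = x.1 ∧ H.step x.2 l y.2))
  init := G.init ×ˢ H.init
  marked := G.marked ×ˢ H.marked
  step_left h := h.1
  step_right := by
    rintro x l y ⟨hx, ⟨e, -, -, h1, h2⟩ | ⟨-, h1, h2⟩ | ⟨-, h1, h2⟩⟩
    · exact ⟨G.step_right h1, H.step_right h2⟩
    · exact ⟨G.step_right h1, h2 ▸ hx.2⟩
    · exact ⟨h1 ▸ hx.1, H.step_right h2⟩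
  step_event := by
    rintro x e y ⟨hx, ⟨e', -, -, h1, h2⟩ | ⟨-, h1, h2⟩ | ⟨-, h1, h2⟩⟩
    · exact Or.inl (G.step_event h1)
    · exact Or.inl (G.step_event h1)
    · exact Or.inr (H.step_event h2)
  init_sub := Set.prod_mono G.init_sub H.init_sub
  marked_sub := Set.prod_mono G.marked_sub H.marked_sub

/-- Synchronous composition `G₁ ∥ ⋯ ∥ Gₘ` of a family: an event is executed jointly by all the
components that have it in their alphabets while the other ones do not move; `τ` is executed by
one component alone. -/
def syncAll {ι : Type*} {P : ι → Type*} (G : ∀ i, Automaton E (P i)) :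
    Automaton E (∀ i, P i) where
  alphabet := ⋃ i, (G i).alphabet
  states := {x | ∀ i, x i ∈ (G i).states}
  step x l y := (∀ i, x i ∈ (G i).states) ∧ (∀ i, y i ∈ (G i).states) ∧
    ((∃ e, l = some e ∧ e ∈ ⋃ i, (G i).alphabet ∧
        ∀ i, (e ∈ (G i).alphabet → (G i).step (x i) (some e) (y i)) ∧
          (e ∉ (G i).alphabet → y i = x i)) ∨
     (l = none ∧ ∃ i, (G i).step (x i) none (y i) ∧ ∀ j, j ≠ i → y j = x j))
  init := {x | ∀ i, x i ∈ (G i).init}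
  marked := {x | ∀ i, x i ∈ (G i).marked}
  step_left h := h.1
  step_right h := h.2.1
  step_event := by
    rintro x e y ⟨-, -, ⟨e', he, h, -⟩ | ⟨h, -⟩⟩
    · cases he; exact h
    · cases h
  init_sub _ hx i := (G i).init_sub (hx i)
  marked_sub _ hx i := (G i).marked_sub (hx i)

/-- The union of a class of automata. -/
def union (C : Set (Automaton E Q)) : Automaton E Q where
  alphabet := {e | ∃ A ∈ C, e ∈ A.alphabet}
  states := {x | ∃ A ∈ C, x ∈ A.states}
  step x l y := ∃ A ∈ C, A.step x l y
  init := {x | ∃ A ∈ C, x ∈ A.init}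
  marked := {x | ∃ A ∈ C, x ∈ A.marked}
  step_left := by rintro _ _ _ ⟨A, hA, h⟩; exact ⟨A, hA, A.step_left h⟩
  step_right := by rintro _ _ _ ⟨A, hA, h⟩; exact ⟨A, hA, A.step_right h⟩
  step_event := by rintro _ _ _ ⟨A, hA, h⟩; exact ⟨A, hA, A.step_event h⟩
  init_sub := by rintro _ ⟨A, hA, h⟩; exact ⟨A, hA, A.init_sub h⟩
  marked_sub := by rintro _ ⟨A, hA, h⟩; exact ⟨A, hA, A.marked_sub h⟩

theorem Path.mono {A B : Automaton E Q} (h : ∀ x l y, A.step x l y → B.step x l y)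
    {x t y} (p : A.Path x t y) : B.Path x t y := by
  induction p with
  | nil x => exact .nil x
  | cons h1 _ ih => exact .cons (h _ _ _ h1) ih

theorem union_sub {C : Set (Automaton E Q)} {P : Automaton E Q} (hne : C.Nonempty)
    (h : ∀ A ∈ C, A.Sub P) : (union C).Sub P where
  alphabet := by
    obtain ⟨A, hA⟩ := hne
    ext e
    refine ⟨?_, fun he => ⟨A, hA, (h A hA).alphabet ▸ he⟩⟩
    rintro ⟨B, hB, he⟩
    exact (h B hB).alphabet ▸ he
  states := by rintro x ⟨A, hA, hx⟩; exact (h A hA).states hx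
  step := by rintro x l y ⟨A, hA, hx⟩; exact (h A hA).step _ _ _ hx
  init := by rintro x ⟨A, hA, hx⟩; exact (h A hA).init hx
  marked := by rintro x ⟨A, hA, hx⟩; exact (h A hA).marked hx

theorem sub_union {C : Set (Automaton E Q)} {P A : Automaton E Q}
    (h : ∀ A ∈ C, A.Sub P) (hA : A ∈ C) : A.Sub (union C) where
  alphabet := (h A hA).alphabet.trans (union_sub ⟨A, hA⟩ h).alphabet.symm
  states _ hx := ⟨A, hA, hx⟩
  step _ _ _ hx := ⟨A, hA, hx⟩
  init _ hx := ⟨A, hA, hx⟩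
  marked _ hx := ⟨A, hA, hx⟩

/-! ### Supervisory control -/

/-- `K` is controllable with respect to `G`, where `uc` is the set of uncontrollable events. -/
def Controllable (uc : Set E) (K G : Automaton E Q) : Prop :=
  ∀ x ∈ K.states, ∀ y ∈ G.states, ∀ u ∈ uc, G.step x (some u) y → K.step x (some u) y

def Nonblocking (K : Automaton E Q) : Prop :=
  ∀ x ∈ K.states, K.Reachable x → K.Coreachable x

/-- Every state is reachable. -/
def Accessible (K : Automaton E Q) : Prop :=
  ∀ x ∈ K.states, K.Reachable x

/-- The controllable and nonblocking (accessible) subautomata of `G`. -/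
def controlledSubs (uc : Set E) (G : Automaton E Q) : Set (Automaton E Q) :=
  {K | K.Sub G ∧ K.Accessible ∧ K.Controllable uc G ∧ K.Nonblocking}

/-- The supremal controllable and nonblocking subautomaton, i.e. the least restrictive
controllable and nonblocking supervisor. It has no states if there is no such supervisor. -/
def supCN (uc : Set E) (G : Automaton E Q) : Automaton E Q :=
  union (controlledSubs uc G)

/-- `supCN` is the largest element of the class of which it is the supremum. -/
theorem supCN_isGreatest (uc : Set E) (G : Automaton E Q) :
    supCN uc G ∈ controlledSubs uc G ∧ ∀ K ∈ controlledSubs uc G, K.Sub (supCN uc G) := by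
  have hsub : ∀ A ∈ controlledSubs uc G, A.Sub G := fun A hA => hA.1
  have hne : (controlledSubs uc G).Nonempty := by
    refine ⟨⟨G.alphabet, ∅, fun _ _ _ => False, ∅, ∅, False.elim, False.elim, False.elim,
      subset_rfl, subset_rfl⟩, ⟨rfl, Set.empty_subset _, fun _ _ _ h => h.elim,
      Set.empty_subset _, Set.empty_subset _⟩, ?_, ?_, ?_⟩ <;> intro x hx <;> exact hx.elim
  have hs : ∀ A ∈ controlledSubs uc G, A.Sub (supCN uc G) := fun A hA => sub_union hsub hA
  refine ⟨⟨union_sub hne hsub, ?_, ?_, ?_⟩, hs⟩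
  · rintro x ⟨A, hA, hx⟩
    obtain ⟨x₀, h0, t, p⟩ := hA.2.1 x hx
    exact ⟨x₀, (hs A hA).init h0, t, p.mono (hs A hA).step⟩
  · rintro x ⟨A, hA, hx⟩ y hy u hu h
    exact ⟨A, hA, hA.2.2.1 x hx y hy u hu h⟩
  · rintro x ⟨A, hA, hx⟩ -
    obtain ⟨y, hy, t, p⟩ := hA.2.2.2 x hx (hA.2.1 x hx)
    exact ⟨y, (hs A hA).marked hy, t, p.mono (hs A hA).step⟩

/-! ### Observers and abstraction -/

/-- Unobservable reach of a set of states. -/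
def UR (G : Automaton E Q) (B : Set Q) : Set Q :=
  {y | ∃ x ∈ B, G.WPath x [] y}

/-- The estimate after the estimate `X` and the observation `e`. -/
def nextEstimate (G : Automaton E Q) (X : Set Q) (e : E) : Set Q :=
  {z | ∃ x ∈ X, ∃ y, G.step x (some e) y ∧ z ∈ G.UR {y}}

/-- The observer `det(G)`: the accessible part of the subset automaton. A transition exists only
if the new estimate is nonempty. -/
def observer (G : Automaton E Q) : Automaton E (Set Q) :=
  acc
    { alphabet := G.alphabet
      states := Set.univ
      step := fun X l Y => ∃ e, l = some e ∧ Y = G.nextEstimate X e ∧ Y.Nonempty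
      init := {G.UR G.init}
      marked := ∅
      step_left := fun _ => trivial
      step_right := fun _ => trivial
      step_event := by
        rintro X e Y ⟨e', he, rfl, z, x, -, y, h, -⟩
        cases he
        exact G.step_event h
      init_sub := Set.subset_univ _
      marked_sub := Set.subset_univ _ }

/-- The desired observer: remove the states in `V`, which violate opacity, and take the
accessible part. -/
def desired (H : Automaton E Q) (V : Set Q) : Automaton E Q :=
  (H.remove V).acc

/-- Bisimulation on `G` (an equivalence relation). -/
def IsBisimulation (G : Automaton E Q) (r : Setoid Q) : Prop :=
  ∀ x₁ ∈ G.states, ∀ x₂ ∈ G.states, r x₁ x₂ →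
    ∀ l y₁, G.step x₁ l y₁ → ∃ y₂, G.step x₂ l y₂ ∧ r y₁ y₂

/-- Opaque observation equivalence on `G` with secret states `S`. -/
def IsOpaqueObsEquiv (G : Automaton E Q) (S : Set Q) (r : Setoid Q) : Prop :=
  ∀ x₁ ∈ G.states, ∀ x₂ ∈ G.states, r x₁ x₂ →
    (∀ s y₁, G.WPath x₁ s y₁ → ∃ y₂, G.WPath x₂ s y₂ ∧ r y₁ y₂) ∧ (x₁ ∈ S ↔ x₂ ∈ S)

/-- Opaque bisimulation on the observer of `G`, with secret states `S` of `G`. -/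
def IsOpaqueBisimulation (G : Automaton E Q) (S : Set Q) (r : Setoid (Set Q)) : Prop :=
  ∀ X₁ ∈ G.observer.states, ∀ X₂ ∈ G.observer.states, r X₁ X₂ →
    (∀ (s : List E) (Y₁ : Set Q), G.observer.Path X₁ (s.map some) Y₁ →
      ∃ Y₂, G.observer.Path X₂ (s.map some) Y₂ ∧ r Y₁ Y₂) ∧ (X₁ ⊆ S ↔ X₂ ⊆ S)

end Automaton

/-! ### Three-player observers -/

/-- `Σ ∪ {ε} ∪ Σ^r`: the labels of a three-player observer. -/
inductive Label (E : Type*)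
  | ev (e : E)
  | eps
  | erase (e : E)

/-- `Σ ∪ Σ^r`: the action components of `W` states. -/
inductive WAction (E : Type*)
  | keep (e : E)
  | erase (e : E)

/-- `Y`, `Z` and `W` states; `xd` and `xf` form the information state. -/
inductive TState (E XD XF : Type*)
  | y (xd : XD) (xf : XF)
  | z (xd : XD) (xf : XF) (e : E)
  | w (xd : XD) (xf : XF) (a : WAction E)

section TPO

variable {E XD XF : Type*}

open Automaton

def TState.IsY : TState E XD XF → Prop
  | .y _ _ => True
  | _ => False

def TState.IsZ : TState E XD XF → Prop
  | .z _ _ _ => True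
  | _ => False

def TState.IsW : TState E XD XF → Prop
  | .w _ _ _ => True
  | _ => False

def WAction.event : WAction E → E
  | .keep e => e
  | .erase e => e

/-- `X_obsd × X_obs`, `(X_obsd × X_obs) × Σ` and `(X_obsd × X_obs) × (Σ ∪ Σ^r)`. -/
def tpoStates (D : Automaton E XD) (F : Automaton E XF) : Set (TState E XD XF)
  | .y xd xf => xd ∈ D.states ∧ xf ∈ F.states
  | .z xd xf e => xd ∈ D.states ∧ xf ∈ F.states ∧ e ∈ F.alphabet
  | .w xd xf a => xd ∈ D.states ∧ xf ∈ F.states ∧ a.event ∈ F.alphabet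

/-- The transitions admissible in a three-player observer with respect to the desired observer
`D` and the observer `F`. -/
inductive Admissible (D : Automaton E XD) (F : Automaton E XF) :
    TState E XD XF → Label E → TState E XD XF → Prop
  | yz {xd xf e xf'} : F.step xf (some e) xf' →
      Admissible D F (.y xd xf) (.ev e) (.z xd xf e)
  | zz {xd xf e θ xd'} : D.step xd (some θ) xd' →
      Admissible D F (.z xd xf e) (.ev θ) (.z xd' xf e)
  | zw1 {xd xf e xd' xf'} : D.step xd (some e) xd' → F.step xf (some e) xf' →
      Admissible D F (.z xd xf e) .eps (.w xd xf (.keep e))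
  | zw2 {xd xf e xf'} : F.step xf (some e) xf' →
      Admissible D F (.z xd xf e) (.erase e) (.w xd xf (.erase e))
  | wy1 {xd xf e xd' xf'} : D.step xd (some e) xd' → F.step xf (some e) xf' →
      Admissible D F (.w xd xf (.keep e)) (.ev e) (.y xd' xf')
  | wy2 {xd xf e xf'} : F.step xf (some e) xf' →
      Admissible D F (.w xd xf (.erase e)) (.ev e) (.y xd xf')

/-- The labels over the alphabet `A`. -/
def labels (A : Set E) : Set (Label E)
  | .ev e => e ∈ A
  | .eps => True
  | .erase e => e ∈ A

/-- `T` is a three-player observer with respect to `D` and `F`. -/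
structure IsTPO (D : Automaton E XD) (F : Automaton E XF)
    (T : Automaton (Label E) (TState E XD XF)) : Prop where
  alphabet : T.alphabet = labels F.alphabet
  states : T.states ⊆ tpoStates D F
  step : ∀ p l q, T.step p l q → ∃ a ∈ labels F.alphabet, l = some a ∧ Admissible D F p a q
  init : T.init = {p | ∃ xd ∈ D.init, ∃ xf ∈ F.init, p = .y xd xf}
  marked : T.marked = {p | p ∈ T.states ∧ p.IsY}

/-- The largest three-player observer with respect to `D` and `F`: all states and all admissible
transitions. The `Y` states are marked. -/
def largestTPO (D : Automaton E XD) (F : Automaton E XF) :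
    Automaton (Label E) (TState E XD XF) where
  alphabet := labels F.alphabet
  states := tpoStates D F
  step p l q := p ∈ tpoStates D F ∧ q ∈ tpoStates D F ∧
    ∃ a ∈ labels F.alphabet, l = some a ∧ Admissible D F p a q
  init := {p | ∃ xd ∈ D.init, ∃ xf ∈ F.init, p = .y xd xf}
  marked := {p | p ∈ tpoStates D F ∧ p.IsY}
  step_left h := h.1
  step_right h := h.2.1
  step_event := by
    rintro p a q ⟨-, -, a', h, h', -⟩
    cases h'
    exact h
  init_sub := by
    rintro p ⟨xd, hd, xf, hf, rfl⟩
    exact ⟨D.init_sub hd, F.init_sub hf⟩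
  marked_sub _ h := h.1

/-- All three-player observers are subautomata of the largest one, which is one itself. -/
theorem largestTPO_isLargest (D : Automaton E XD) (F : Automaton E XF) :
    IsTPO D F (largestTPO D F) ∧ ∀ T, IsTPO D F T → T.Sub (largestTPO D F) := by
  refine ⟨⟨rfl, subset_rfl, fun _ _ _ h => h.2.2, rfl, rfl⟩, fun T hT => ⟨hT.alphabet,
    hT.states, fun p l q h => ⟨hT.states (T.step_left h), hT.states (T.step_right h),
      hT.step _ _ _ h⟩, hT.init.subset, ?_⟩⟩
  intro p hp
  rw [hT.marked] at hp
  exact ⟨hT.states hp.1, hp.2⟩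

/-! ### Runs and edit functions -/

/-- One round `y →^e z →^θ₁ ⋯ →^θ_{m-1} z →^θ_m w →^e y'` of a run: the events `θ₁, …, θ_{m-1}`
are inserted, and `θ_m` is `e → ε` or `ε` according to whether `e` is erased or not. -/
structure Round (E : Type*) where
  event : E
  inserted : List E
  erased : Bool

def Round.word (c : Round E) : List (Label E) :=
  .ev c.event :: (c.inserted.map .ev ++
    [if c.erased then .erase c.event else .eps, .ev c.event])

def Round.output (c : Round E) : List E :=
  c.inserted ++ if c.erased then [] else [c.event]

/-- The label sequence of the run that consists of the given rounds. -/
def runWord (ω : List (Round E)) : List (Label E) := ω.flatMap Round.word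

/-- The string `l(ω)` generated by a run. -/
def runString (ω : List (Round E)) : List E := ω.flatMap Round.output

/-- The edit projection `P_e(ω)`. -/
def editProj (ω : List (Round E)) : List E := ω.map Round.event

/-- A deterministic edit function: `f s σ` is the output for the event `σ` after the string `s`. -/
abbrev EditFunction (E : Type*) := List E → E → List E

def EditFunction.outputFrom (f : EditFunction E) : List E → List E → List E
  | _, [] => []
  | s, e :: u => f s e ++ f.outputFrom (s ++ [e]) u

/-- The string-based edit function. -/
def EditFunction.output (f : EditFunction E) (s : List E) : List E := f.outputFrom [] s

theorem EditFunction.output_nil (f : EditFunction E) : f.output [] = [] := rfl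

theorem EditFunction.output_snoc (f : EditFunction E) (s : List E) (e : E) :
    f.output (s ++ [e]) = f.output s ++ f s e := by
  have : ∀ u v, f.outputFrom v (u ++ [e]) = f.outputFrom v u ++ f (v ++ u) e := by
    intro u
    induction u with
    | nil => intro v; simp [EditFunction.outputFrom]
    | cons a u ih => intro v; simp [EditFunction.outputFrom, ih]
  simpa [EditFunction.output] using this s []

/-! ### The edit constraint and the All Edit Structure -/

/-- The number of consecutive erasures up to now, updated by a transition with label `a` from the
state `p`. The edit decisions are the labels of transitions from `Z` states: an erasure increases
the number by one, every other decision resets it to zero. -/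
def erasureCount : TState E XD XF → Label E → ℕ → ℕ
  | .z _ _ _, .erase _, k => k + 1
  | .z _ _ _, _, _ => 0
  | _, _, k => k

/-- The three-player observer `T` under the constraint that there are no `n + 1` consecutive
erasures. The constraint depends on the past decisions, so that a state is a state of `T` together
with the number of consecutive erasures that led to it. -/
def constrained (n : ℕ) (T : Automaton (Label E) (TState E XD XF)) :
    Automaton (Label E) (TState E XD XF × ℕ) where
  alphabet := T.alphabet
  states := {p | p.1 ∈ T.states ∧ p.2 ≤ n}
  step p l q := T.step p.1 l q.1 ∧ p.2 ≤ n ∧ q.2 ≤ n ∧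
    ∃ a, l = some a ∧ q.2 = erasureCount p.1 a p.2
  init := {p | p.1 ∈ T.init ∧ p.2 = 0}
  marked := {p | p.1 ∈ T.marked ∧ p.2 ≤ n}
  step_left h := ⟨T.step_left h.1, h.2.1⟩
  step_right h := ⟨T.step_right h.1, h.2.2.1⟩
  step_event h := T.step_event h.1
  init_sub _ h := ⟨T.init_sub h.1, h.2.le.trans (Nat.zero_le _)⟩
  marked_sub _ h := ⟨T.marked_sub h.1, h.2⟩

/-- `ω` is a run of `A`: it starts in the initial state and ends in a `Y` state. -/
def HasRun (A : Automaton (Label E) (TState E XD XF × ℕ)) (ω : List (Round E)) : Prop :=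
  ∃ p ∈ A.init, ∃ q, q.1.IsY ∧ A.Path p ((runWord ω).map some) q

/-- Completeness of a substructure `A` of `T` for a system with language `L`: there are no
deadlocking `Z` or `W` states, no output of the system is disabled at a `Y` state, and every
string of the system is processed by some run. -/
structure IsCompleteTPO (T : Automaton (Label E) (TState E XD XF × ℕ)) (L : Set (List E))
    (A : Automaton (Label E) (TState E XD XF × ℕ)) : Prop where
  z_alive : ∀ p ∈ A.states, p.1.IsZ → ∃ l q, A.step p l q
  w_alive : ∀ p ∈ A.states, p.1.IsW → ∃ l q, A.step p l q
  y_closed : ∀ p ∈ A.states, p.1.IsY → ∀ l q, T.step p l q → A.step p l q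
  total : ∀ s ∈ L, ∃ ω, HasRun A ω ∧ editProj ω = s

/-- The complete three-player observers with respect to `D` and `F` that satisfy the constraint. -/
def completeTPOs (n : ℕ) (D : Automaton E XD) (F : Automaton E XF) (L : Set (List E)) :
    Set (Automaton (Label E) (TState E XD XF × ℕ)) :=
  {A | A.Sub (constrained n (largestTPO D F)) ∧ IsCompleteTPO (constrained n (largestTPO D F)) L A}

/-- The All Edit Structure: the largest complete three-player observer that satisfies the
constraint. It is empty if there is no such observer. -/
def allEditStructure (n : ℕ) (D : Automaton E XD) (F : Automaton E XF) (L : Set (List E)) :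
    Automaton (Label E) (TState E XD XF × ℕ) :=
  union (completeTPOs n D F L)

/-- The All Edit Structure is the largest complete three-player observer if there is any. -/
theorem allEditStructure_isGreatest (n : ℕ) (D : Automaton E XD) (F : Automaton E XF)
    (L : Set (List E)) (hne : (completeTPOs n D F L).Nonempty) :
    allEditStructure n D F L ∈ completeTPOs n D F L ∧
      ∀ A ∈ completeTPOs n D F L, A.Sub (allEditStructure n D F L) := by
  have hsub : ∀ A ∈ completeTPOs n D F L, A.Sub (constrained n (largestTPO D F)) :=
    fun A hA => hA.1
  have hs : ∀ A ∈ completeTPOs n D F L, A.Sub (allEditStructure n D F L) :=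
    fun A hA => sub_union hsub hA
  refine ⟨⟨union_sub hne hsub, ⟨?_, ?_, ?_, ?_⟩⟩, hs⟩
  · rintro p ⟨A, hA, hp⟩ hz
    obtain ⟨l, q, h⟩ := hA.2.z_alive p hp hz
    exact ⟨l, q, A, hA, h⟩
  · rintro p ⟨A, hA, hp⟩ hz
    obtain ⟨l, q, h⟩ := hA.2.w_alive p hp hz
    exact ⟨l, q, A, hA, h⟩
  · rintro p ⟨A, hA, hp⟩ hy l q h
    exact ⟨A, hA, hA.2.y_closed p hp hy l q h⟩
  · intro s hsL
    obtain ⟨A, hA⟩ := hne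
    obtain ⟨ω, ⟨p, hp, q, hq, hpath⟩, hω⟩ := hA.2.total s hsL
    exact ⟨ω, ⟨p, (hs A hA).init hp, q, hq, hpath.mono (hs A hA).step⟩, hω⟩

/-- `f` is embedded in `A`, for a system with language `L`. -/
def EditFunction.EmbeddedIn (f : EditFunction E) (L : Set (List E))
    (A : Automaton (Label E) (TState E XD XF × ℕ)) : Prop :=
  ∀ s ∈ L, ∃ ω, HasRun A ω ∧ editProj ω = s ∧ runString ω = f.output s

/-! ### Transformation of three-player observers to automata -/

/-- Events of the transformed automata: `e` (from `Y` states), `θ_e` (from `Z` states with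
observable event component `e`) and `e_{a,w}` (from `W` states with action component `a`). -/
inductive TEvent (E : Type*)
  | plain (e : E)
  | dec (θ : Label E) (e : E)
  | env (e : E) (a : WAction E)

/-- The renaming `ρ`. -/
def TEvent.rename : TEvent E → Label E
  | .plain e => .ev e
  | .dec θ _ => θ
  | .env e _ => .ev e

/-- Events from `Y` and `W` states are uncontrollable. -/
def TEvent.uncontrollable (E : Type*) : Set (TEvent E)
  | .plain _ => True
  | .dec _ _ => False
  | .env _ _ => True

/-- The observable events of a three-player observer. -/
def observables {Q : Type*} (T : Automaton (Label E) Q) : Set E := {e | .ev e ∈ T.alphabet}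

/-- Transitions of the monolithic transformed automaton. -/
inductive MonoStep (T : Automaton (Label E) (TState E XD XF)) :
    TState E XD XF → Option (TEvent E) → TState E XD XF → Prop
  | y {xd xf e q} : T.step (.y xd xf) (some (.ev e)) q →
      MonoStep T (.y xd xf) (some (.plain e)) q
  | z {xd xf e θ q} : T.step (.z xd xf e) (some θ) q →
      MonoStep T (.z xd xf e) (some (.dec θ e)) q
  | w {xd xf a e q} : T.step (.w xd xf a) (some (.ev e)) q →
      MonoStep T (.w xd xf a) (some (.env e a)) q

/-- The monolithic transformed automaton `M^T`. -/
def monoAutomaton (T : Automaton (Label E) (TState E XD XF)) :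
    Automaton (TEvent E) (TState E XD XF) where
  alphabet := {u | (∃ e ∈ observables T, u = .plain e) ∨
    (∃ θ ∈ T.alphabet, ∃ xd xf e, .z xd xf e ∈ T.states ∧ u = .dec θ e) ∨
    (∃ e ∈ observables T, ∃ xd xf a, .w xd xf a ∈ T.states ∧ u = .env e a)}
  states := T.states
  step := MonoStep T
  init := T.init
  marked := {p | p ∈ T.states ∧ p.IsY}
  step_left := by rintro _ _ _ (h | h | h) <;> exact T.step_left h
  step_right := by rintro _ _ _ (h | h | h) <;> exact T.step_right h
  step_event := by
    rintro _ _ _ (h | h | h)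
    · exact Or.inl ⟨_, T.step_event h, rfl⟩
    · exact Or.inr (Or.inl ⟨_, T.step_event h, _, _, _, T.step_left h, rfl⟩)
    · exact Or.inr (Or.inr ⟨_, T.step_event h, _, _, _, T.step_left h, rfl⟩)
  init_sub := T.init_sub
  marked_sub _ h := h.1

end TPO

section Modular

variable {E ι : Type*} {XD XF : ι → Type*}

open Automaton

/-- The transformed automaton `G_i^T` in a system of three-player observers: at the `Y` states
there are self-loops with the events of the other components, and a shared event `σ` decorated
with an event `α` of another component that is not an event of component `i` belongs to the
alphabet (and is hence disabled by component `i`). -/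
def transformed (T : ∀ i, Automaton (Label E) (TState E (XD i) (XF i))) (i : ι) :
    Automaton (TEvent E) (TState E (XD i) (XF i)) where
  alphabet := (monoAutomaton (T i)).alphabet ∪
    {u | ∃ j, j ≠ i ∧ ∃ α ∈ observables (T j) \ observables (T i), u = .plain α ∨
      ∃ σ ∈ observables (T i) ∩ observables (T j),
        u = .dec (.ev σ) α ∨ u = .env σ (.keep α) ∨ u = .env σ (.erase α)}
  states := (T i).states
  step p l q := (monoAutomaton (T i)).step p l q ∨
    (p ∈ (T i).states ∧ p.IsY ∧ q = p ∧
      ∃ j, j ≠ i ∧ ∃ α ∈ observables (T j) \ observables (T i), l = some (.plain α))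
  init := (monoAutomaton (T i)).init
  marked := (monoAutomaton (T i)).marked
  step_left := by
    rintro _ _ _ (h | h)
    · exact (monoAutomaton (T i)).step_left h
    · exact h.1
  step_right := by
    rintro _ _ _ (h | ⟨h, -, rfl, -⟩)
    · exact (monoAutomaton (T i)).step_right h
    · exact h
  step_event := by
    rintro _ _ _ (h | ⟨-, -, -, j, hj, α, hα, h⟩)
    · exact Or.inl ((monoAutomaton (T i)).step_event h)
    · cases h
      exact Or.inr ⟨j, hj, α, hα, Or.inl rfl⟩
  init_sub := (monoAutomaton (T i)).init_sub
  marked_sub := (monoAutomaton (T i)).marked_sub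

/-- The events `(α → ε)_α` of the system of three-player observers. -/
def erasureEvents (T : ∀ i, Automaton (Label E) (TState E (XD i) (XF i))) : Set (TEvent E) :=
  {u | ∃ i xd xf e q, (T i).step (.z xd xf e) (some (.erase e)) q ∧ u = .dec (.erase e) e}

/-- The events `ε_α` and `α_σ` of the system of three-player observers. -/
def resetEvents (T : ∀ i, Automaton (Label E) (TState E (XD i) (XF i))) : Set (TEvent E) :=
  {u | ∃ i xd xf e q, (T i).step (.z xd xf e) (some .eps) q ∧ u = .dec .eps e} ∪
  {u | ∃ i xd xf e α q, (T i).step (.z xd xf e) (some (.ev α)) q ∧ u = .dec (.ev α) e}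

/-- The specification automaton `K` of the constraint that there are no `n + 1` consecutive
erasures. The state `k ≤ n + 1` is reached after `k` consecutive erasures; the last state `n + 1`
is not marked and has no outgoing transitions. -/
def specification (n : ℕ) (T : ∀ i, Automaton (Label E) (TState E (XD i) (XF i))) :
    Automaton (TEvent E) ℕ where
  alphabet := erasureEvents T ∪ resetEvents T
  states := {k | k ≤ n + 1}
  step k l k' := k ≤ n ∧
    ((∃ u ∈ erasureEvents T, l = some u ∧ k' = k + 1) ∨ (∃ u ∈ resetEvents T, l = some u ∧ k' = 0))
  init := {0}
  marked := {k | k ≤ n}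
  step_left h := Nat.le_succ_of_le h.1
  step_right := by
    rintro k l k' ⟨h, ⟨u, -, -, rfl⟩ | ⟨u, -, -, rfl⟩⟩
    · exact Nat.succ_le_succ h
    · exact Nat.zero_le _
  step_event := by
    rintro k u k' ⟨h, ⟨u', hu, h', -⟩ | ⟨u', hu, h', -⟩⟩ <;> cases h'
    · exact Or.inl hu
    · exact Or.inr hu
  init_sub := by
    rintro k rfl
    exact Nat.zero_le _
  marked_sub _ h := Nat.le_succ_of_le h

/-- The least restrictive controllable and nonblocking supervisor calculated from
`{G_1^T, …, G_m^T, K}`. -/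
def modularSupervisor (n : ℕ) (T : ∀ i, Automaton (Label E) (TState E (XD i) (XF i))) :
    Automaton (TEvent E) ((∀ i, TState E (XD i) (XF i)) × ℕ) :=
  supCN (TEvent.uncontrollable E) ((syncAll (transformed T)).sync (specification n T))

/-- The secret states of a modular system. -/
def modularSecret {Q : ι → Type*} (S : ∀ i, Set (Q i)) : Set (∀ i, Q i) :=
  {x | ∃ i, x i ∈ S i}

end Modular

section Components

variable {E Q : Type*}

open Automaton

/-- The All Edit Structure of a system with secret states `S`, with respect to its observer and
its desired observer. -/
def systemAES (n : ℕ) (G : Automaton E Q) (S : Set Q) :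
    Automaton (Label E) (TState E (Set Q) (Set Q) × ℕ) :=
  allEditStructure n (G.observer.desired {X | X ⊆ S}) G.observer G.lang

/-- The largest three-player observer of an abstracted component. The component `G` with secret
states `S` is abstracted to `G.quot r`, whose secret states are the classes of those in `S`. Its
observer is abstracted modulo `ro` to `H_ob` and modulo `rb` to `H_b`; the states of `H_ob` that
violate opacity are the classes of the estimates that contain only secret states. -/
def abstractTPO (G : Automaton E Q) (S : Set Q) (r : Setoid Q)
    (ro rb : Setoid (Set (Quotient r))) :
    Automaton (Label E) (TState E (Quotient ro) (Quotient rb)) :=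
  largestTPO
    (((G.quot r).observer.quot ro).desired
      (Quotient.mk ro '' {X | X ∈ (G.quot r).observer.states ∧ X ⊆ Quotient.mk r '' S}))
    ((G.quot r).observer.quot rb)

end Components

/-!
Estimates of a composition are products of estimates of the components, and a product of estimates
none of which consists of secret states only contains a non-secret state. Hence the compositions of
the abstracted observers and of their desired observers are simulated by `det(G)` and `det_d(G)`.

A joint transition of the automata `G_i^T` is a transition of the largest three-player observer of
these compositions in which the components that ignore the current event rest in their `Y`-states;
the decorated events that are added to the alphabets rule out joint decisions without a global
counterpart. So the supervisor is simulated by the largest three-player observer of the system under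
the constraint. As it is controllable it disables no output of the system, and as it is nonblocking
it can complete every round; the part of the three-player observer that it reaches is therefore
complete, and is contained in the All Edit Structure. Extending its runs event by event produces the
edit functions.
-/

/-! ### Paths and observers -/

namespace Automaton

variable {E Q : Type*} {G : Automaton E Q}

theorem Path.append {x y z : Q} {s t : List (Option E)} (p : G.Path x s y) (q : G.Path y t z) :
    G.Path x (s ++ t) z := by
  induction p with
  | nil x => exact q
  | cons h _ ih => exact .cons h (ih q)

theorem Path.single {x y : Q} {l : Option E} (h : G.step x l y) : G.Path x [l] y :=
  .cons h (.nil y)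

theorem path_nil_iff {x y : Q} : G.Path x [] y ↔ y = x := by
  constructor
  · rintro ⟨⟩
    rfl
  · rintro rfl
    exact .nil y

theorem path_cons_iff {x z : Q} {l : Option E} {t : List (Option E)} :
    G.Path x (l :: t) z ↔ ∃ y, G.step x l y ∧ G.Path y t z := by
  refine ⟨fun p => ?_, fun ⟨_, h, p⟩ => .cons h p⟩
  cases p with
  | cons h p => exact ⟨_, h, p⟩

theorem path_append_iff {x z : Q} {s t : List (Option E)} :
    G.Path x (s ++ t) z ↔ ∃ y, G.Path x s y ∧ G.Path y t z := by
  refine ⟨fun p => ?_, fun ⟨_, p, q⟩ => p.append q⟩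
  induction s generalizing x with
  | nil => exact ⟨x, .nil x, p⟩
  | cons l s ih =>
    obtain ⟨y, h, p⟩ := path_cons_iff.1 p
    obtain ⟨y', p, q⟩ := ih p
    exact ⟨y', .cons h p, q⟩

theorem Path.mem_states {x y : Q} {t : List (Option E)} (p : G.Path x t y) (hx : x ∈ G.states) :
    y ∈ G.states := by
  induction p with
  | nil x => exact hx
  | cons h _ ih => exact ih (G.step_right h)

theorem Path.reachable {x y : Q} {t : List (Option E)} (p : G.Path x t y) (hx : G.Reachable x) :
    G.Reachable y :=
  let ⟨x₀, h₀, s, q⟩ := hx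
  ⟨x₀, h₀, s ++ t, q.append p⟩

theorem Path.wpath {x y : Q} {s : List E} (p : G.Path x (s.map some) y) : G.WPath x s y :=
  ⟨_, by simp [List.reduceOption, List.filterMap_map], p⟩

theorem WPath.refl (G : Automaton E Q) (x : Q) : G.WPath x [] x := ⟨[], rfl, .nil x⟩

theorem WPath.trans {x y z : Q} {s t : List E} (p : G.WPath x s y) (q : G.WPath y t z) :
    G.WPath x (s ++ t) z := by
  obtain ⟨s, rfl, p⟩ := p
  obtain ⟨t, rfl, q⟩ := q
  exact ⟨s ++ t, List.reduceOption_append s t, p.append q⟩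

theorem WPath.of_step {x y : Q} {l : Option E} (h : G.step x l y) : G.WPath x l.toList y :=
  ⟨[l], by cases l <;> rfl, .single h⟩

theorem WPath.mem_states {x y : Q} {s : List E} (p : G.WPath x s y) (hx : x ∈ G.states) :
    y ∈ G.states :=
  let ⟨_, _, p⟩ := p
  p.mem_states hx

theorem wpath_append_iff {x z : Q} {s t : List E} :
    G.WPath x (s ++ t) z ↔ ∃ y, G.WPath x s y ∧ G.WPath y t z := by
  refine ⟨fun ⟨u, hu, p⟩ => ?_, fun ⟨_, p, q⟩ => p.trans q⟩
  obtain ⟨v, w, rfl, rfl, rfl⟩ := (List.reduceOption_eq_append_iff _ _ _).1 hu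
  obtain ⟨y, p, q⟩ := path_append_iff.1 p
  exact ⟨y, ⟨v, rfl, p⟩, w, rfl, q⟩

theorem wpath_singleton_iff {x y : Q} {e : E} :
    G.WPath x [e] y ↔
      ∃ x' y', G.WPath x [] x' ∧ G.step x' (some e) y' ∧ G.WPath y' [] y := by
  constructor
  · rintro ⟨t, ht, p⟩
    obtain ⟨k, l, rfl⟩ := (List.reduceOption_eq_singleton_iff _ _).1 ht
    obtain ⟨x', p, q⟩ := path_append_iff.1 p
    obtain ⟨y', h, q⟩ := path_cons_iff.1 q
    exact ⟨x', y', ⟨_, List.reduceOption_replicate_none, p⟩, h,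
      _, List.reduceOption_replicate_none, q⟩
  · rintro ⟨x', y', p, h, q⟩
    simpa using (p.trans (.of_step h)).trans q

theorem WPath.silent_induction {P : Q → Prop} {x y : Q} (p : G.WPath x [] y) (hx : P x)
    (h : ∀ a b, P a → G.step a none b → P b) : P y := by
  obtain ⟨t, ht, p⟩ := p
  induction p with
  | nil x => exact hx
  | @cons _ _ _ l _ hl _ ih =>
    cases l with
    | none => exact ih (h _ _ hx hl) (by simpa using ht)
    | some a => simp at ht

theorem lang_prefix_closed {s t : List E} (h : s ++ t ∈ G.lang) : s ∈ G.lang :=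
  let ⟨x, hx, _, p⟩ := h
  let ⟨y, p, _⟩ := wpath_append_iff.1 p
  ⟨x, hx, y, p⟩

/-- All transitions of the automaton are observable, so that its weak paths are its paths. -/
def TauFree (G : Automaton E Q) : Prop := ∀ x y, ¬ G.step x none y

theorem Path.map_some_reduceOption (hG : G.TauFree) {x y : Q} {t : List (Option E)}
    (p : G.Path x t y) : t.reduceOption.map some = t := by
  induction p with
  | nil => rfl
  | @cons _ _ _ l t h _ ih =>
    cases l with
    | none => exact (hG _ _ h).elim
    | some e => simpa using ih

theorem wpath_iff_path (hG : G.TauFree) {x y : Q} {s : List E} :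
    G.WPath x s y ↔ G.Path x (s.map some) y := by
  refine ⟨?_, Path.wpath⟩
  rintro ⟨t, rfl, p⟩
  rwa [p.map_some_reduceOption hG]

/-- Automata without unobservable transitions, with at most one initial state, and with at most
one successor of each state under each event. -/
structure IsDeterministic (G : Automaton E Q) : Prop where
  tauFree : G.TauFree
  init_unique : ∀ x ∈ G.init, ∀ y ∈ G.init, x = y
  step_unique : ∀ x e y z, G.step x (some e) y → G.step x (some e) z → y = z

theorem IsDeterministic.path_unique (hG : G.IsDeterministic) {x y z : Q} {s : List E}
    (p : G.Path x (s.map some) y) (q : G.Path x (s.map some) z) : y = z := by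
  induction s generalizing x with
  | nil => exact (path_nil_iff.1 p).trans (path_nil_iff.1 q).symm
  | cons e s ih =>
    obtain ⟨x', h, p⟩ := path_cons_iff.1 p
    obtain ⟨x'', h', q⟩ := path_cons_iff.1 q
    obtain rfl := hG.step_unique _ _ _ _ h h'
    exact ih p q

theorem IsDeterministic.exists_step_of_mem_lang (hG : G.IsDeterministic) {x₀ x : Q} {s : List E}
    {e : E} (hx₀ : x₀ ∈ G.init) (p : G.Path x₀ (s.map some) x) (h : s ++ [e] ∈ G.lang) :
    ∃ y, G.step x (some e) y := by
  obtain ⟨x₁, hx₁, y, q⟩ := h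
  obtain rfl := hG.init_unique _ hx₀ _ hx₁
  obtain ⟨x', q, h⟩ := wpath_append_iff.1 q
  obtain rfl := hG.path_unique p ((wpath_iff_path hG.tauFree).1 q)
  obtain ⟨y', h, -⟩ := path_cons_iff.1 ((wpath_iff_path hG.tauFree).1 h)
  exact ⟨y', h⟩

theorem acc_step_iff {x y : Q} {l : Option E} (hx : x ∈ G.acc.states) :
    G.acc.step x l y ↔ G.step x l y :=
  ⟨fun h => h.1, fun h => ⟨h, hx.2, (Path.single h).reachable hx.2⟩⟩

theorem desired_step_iff {V : Set Q} {x y : Q} {l : Option E} (hx : x ∈ (G.desired V).states) :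
    (G.desired V).step x l y ↔ G.step x l y ∧ y ∉ V :=
  (acc_step_iff hx).trans ⟨fun h => ⟨h.1, h.2.2⟩, fun h => ⟨h.1, hx.1.2, h.2⟩⟩

/-- The states that are reachable from `X` by weak paths labelled `s`. -/
def after (G : Automaton E Q) (X : Set Q) (s : List E) : Set Q := {y | ∃ x ∈ X, G.WPath x s y}

theorem after_append (X : Set Q) (s t : List E) :
    G.after X (s ++ t) = G.after (G.after X s) t := by
  ext z
  simp only [after, wpath_append_iff, Set.mem_ofPred_eq]
  grind

/-- Sets of states that are closed under unobservable reach. -/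
structure IsEstimate (G : Automaton E Q) (X : Set Q) : Prop where
  sub : X ⊆ G.states
  closed : G.after X [] ⊆ X

theorem IsEstimate.after_nil {X : Set Q} (hX : G.IsEstimate X) : G.after X [] = X :=
  hX.closed.antisymm fun x hx => ⟨x, hx, .refl G x⟩

theorem isEstimate_after {X : Set Q} (hX : X ⊆ G.states) (s : List E) :
    G.IsEstimate (G.after X s) where
  sub := by rintro y ⟨x, hx, p⟩; exact p.mem_states (hX hx)
  closed := by rw [← after_append, List.append_nil]

theorem IsEstimate.nextEstimate_eq {X : Set Q} (hX : G.IsEstimate X) (e : E) :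
    G.nextEstimate X e = G.after X [e] := by
  ext z
  constructor
  · rintro ⟨x, hx, y, h, _, rfl, p⟩
    exact ⟨x, hx, wpath_singleton_iff.2 ⟨x, _, .refl G x, h, p⟩⟩
  · rintro ⟨x, hx, p⟩
    obtain ⟨x', y, p, h, q⟩ := wpath_singleton_iff.1 p
    exact ⟨x', hX.closed ⟨x, hx, p⟩, y, h, y, rfl, q⟩

theorem IsEstimate.nextEstimate {X : Set Q} (hX : G.IsEstimate X) (e : E) :
    G.IsEstimate (G.nextEstimate X e) :=
  hX.nextEstimate_eq e ▸ isEstimate_after hX.sub [e]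

theorem observer_step_iff {X Y : Set Q} {l : Option E} (hX : X ∈ G.observer.states) :
    G.observer.step X l Y ↔ ∃ e, l = some e ∧ Y = G.nextEstimate X e ∧ Y.Nonempty :=
  acc_step_iff hX

theorem observer_step_some_iff {X Y : Set Q} {e : E} (hX : X ∈ G.observer.states) :
    G.observer.step X (some e) Y ↔ Y = G.nextEstimate X e ∧ Y.Nonempty := by
  simp [observer_step_iff hX]

theorem observer_isDeterministic (G : Automaton E Q) : G.observer.IsDeterministic where
  tauFree X Y h := by
    obtain ⟨e, he, -⟩ := (observer_step_iff (G.observer.step_left h)).1 h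
    cases he
  init_unique X hX Y hY := hX.trans hY.symm
  step_unique X e Y Z h h' := by
    have hX := G.observer.step_left h
    exact ((observer_step_some_iff hX).1 h).1.trans ((observer_step_some_iff hX).1 h').1.symm

theorem UR_init_mem_observer (G : Automaton E Q) : G.UR G.init ∈ G.observer.states :=
  G.observer.init_sub rfl

theorem observer_path_iff {X Y : Set Q} (hX : X ∈ G.observer.states) (hX' : G.IsEstimate X)
    (hne : X.Nonempty) {s : List E} :
    G.observer.Path X (s.map some) Y ↔ Y = G.after X s ∧ Y.Nonempty := by
  induction s generalizing X with
  | nil =>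
    rw [List.map_nil, path_nil_iff, hX'.after_nil]
    exact ⟨fun h => ⟨h, h ▸ hne⟩, And.left⟩
  | cons e s ih =>
    have hafter : G.after X (e :: s) = G.after (G.nextEstimate X e) s := by
      rw [hX'.nextEstimate_eq, ← after_append, List.singleton_append]
    rw [List.map_cons, path_cons_iff, hafter]
    constructor
    · rintro ⟨Z, h, p⟩
      obtain ⟨rfl, hZ⟩ := (observer_step_some_iff hX).1 h
      exact (ih (G.observer.step_right h) (hX'.nextEstimate e) hZ).1 p
    · rintro ⟨rfl, hY⟩
      have hZ : (G.nextEstimate X e).Nonempty := let ⟨_, x, hx, _⟩ := hY; ⟨x, hx⟩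
      have h := (observer_step_some_iff hX).2 ⟨rfl, hZ⟩
      exact ⟨_, h, (ih (G.observer.step_right h) (hX'.nextEstimate e) hZ).2 ⟨rfl, hY⟩⟩

theorem observer_lang (hne : (G.UR G.init).Nonempty) : G.observer.lang = G.lang := by
  ext s
  have hafter : G.after (G.UR G.init) s = G.after G.init s :=
    (after_append G.init [] s).symm
  trans (G.after G.init s).Nonempty
  · have hpath {Y : Set Q} := observer_path_iff (Y := Y) (UR_init_mem_observer G)
      (isEstimate_after G.init_sub []) hne (s := s)
    constructor
    · rintro ⟨_, rfl, Y, p⟩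
      obtain ⟨rfl, h⟩ := hpath.1 ((wpath_iff_path (observer_isDeterministic G).tauFree).1 p)
      rwa [← hafter]
    · exact fun h => ⟨_, rfl, _, (hpath.2 ⟨rfl, hafter ▸ h⟩).wpath⟩
  · exact ⟨fun ⟨y, x, hx, p⟩ => ⟨x, hx, y, p⟩, fun ⟨x, hx, y, p⟩ => ⟨y, x, hx, p⟩⟩

/-! ### Simulations and synchronous composition -/

section Simulation

variable {E' E'' Q' Q'' : Type*}

/-- Every behaviour of `A` is matched, up to the relabelling `φ` of its events, by a behaviour of
`B` through the relation `R`. -/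
structure IsSimulation (φ : E → E') (A : Automaton E Q) (B : Automaton E' Q') (R : Q → Q' → Prop) :
    Prop where
  mem : ∀ {a b}, R a b → b ∈ B.states
  init : ∀ a ∈ A.init, ∃ b ∈ B.init, R a b
  step : ∀ {a b}, R a b → ∀ {e a'}, A.step a (some e) a' →
    ∃ b', B.step b (some (φ e)) b' ∧ R a' b'

variable {φ : E → E'} {A : Automaton E Q} {B : Automaton E' Q'} {R : Q → Q' → Prop}

theorem IsSimulation.comp {ψ : E' → E''} {C : Automaton E'' Q''} {R' : Q' → Q'' → Prop}
    (h' : IsSimulation ψ B C R') (h : IsSimulation φ A B R) :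
    IsSimulation (ψ ∘ φ) A C (Relation.Comp R R') where
  mem := by rintro a c ⟨b, -, hbc⟩; exact h'.mem hbc
  init a ha :=
    let ⟨b, hb, hab⟩ := h.init a ha
    let ⟨c, hc, hbc⟩ := h'.init b hb
    ⟨c, hc, b, hab, hbc⟩
  step := by
    rintro a c ⟨b, hab, hbc⟩ e a' ha
    obtain ⟨b', hb, hab'⟩ := h.step hab ha
    obtain ⟨c', hc, hbc'⟩ := h'.step hbc hb
    exact ⟨c', hc, b', hab', hbc'⟩

theorem IsSimulation.path (h : IsSimulation φ A B R) {a a' : Q} {b : Q'} (hab : R a b)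
    {s : List E} (p : A.Path a (s.map some) a') :
    ∃ b', B.Path b ((s.map φ).map some) b' ∧ R a' b' := by
  induction s generalizing a b with
  | nil => exact ⟨b, .nil b, path_nil_iff.1 p ▸ hab⟩
  | cons e s ih =>
    obtain ⟨a₁, ha, p⟩ := path_cons_iff.1 p
    obtain ⟨b₁, hb, hab₁⟩ := h.step hab ha
    obtain ⟨b', q, hab'⟩ := ih hab₁ p
    exact ⟨b', .cons hb q, hab'⟩

/-- The subautomaton of `B` on the states that are related by `R` to a state of `A`. -/
def simulatedPart (A : Automaton E Q) (B : Automaton E' Q') (R : Q → Q' → Prop) :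
    Automaton E' Q' :=
  B.remove {b | ¬ ∃ a ∈ A.states, R a b}

theorem remove_sub (G : Automaton E Q) (V : Set Q) : (G.remove V).Sub G :=
  ⟨rfl, Set.sdiff_subset, fun _ _ _ h => h.1, Set.sdiff_subset, Set.sdiff_subset⟩

theorem exists_of_mem_simulatedPart {b : Q'} (h : b ∈ (simulatedPart A B R).states) :
    ∃ a ∈ A.states, R a b :=
  not_not.1 h.2

theorem simulatedPart_step {a a' : Q} {b b' : Q'} {l : Option E'} (ha : a ∈ A.states)
    (hab : R a b) (ha' : a' ∈ A.states) (hab' : R a' b') (h : B.step b l b') :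
    (simulatedPart A B R).step b l b' :=
  ⟨h, not_not.2 ⟨a, ha, hab⟩, not_not.2 ⟨a', ha', hab'⟩⟩

theorem IsSimulation.simulatedPart (h : IsSimulation φ A B R) :
    IsSimulation φ A (simulatedPart A B R) fun a b => a ∈ A.states ∧ R a b where
  mem := fun {a _} hab => ⟨h.mem hab.2, not_not.2 ⟨a, hab⟩⟩
  init a ha :=
    let ⟨b, hb, hab⟩ := h.init a ha
    have ha := A.init_sub ha
    ⟨b, ⟨hb, not_not.2 ⟨a, ha, hab⟩⟩, ha, hab⟩
  step := by
    rintro a b ⟨ha, hab⟩ e a' hs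
    obtain ⟨b', hb, hab'⟩ := h.step hab hs
    have ha' := A.step_right hs
    exact ⟨b', simulatedPart_step ha hab ha' hab' hb, ha', hab'⟩

theorem desired_sub (G : Automaton E Q) (V : Set Q) : (G.desired V).Sub G where
  alphabet := rfl
  states _ h := h.1.1
  step _ _ _ h := h.1.1
  init _ h := h.1
  marked _ h := h.1.1

theorem IsSimulation.desired (h : IsSimulation φ A B R) {A' : Automaton E Q} (hA : A'.Sub A)
    {W : Set Q'} (hW : ∀ a ∈ A'.states, ∀ b, R a b → b ∉ W) :
    IsSimulation φ A' (B.desired W) fun a b =>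
      a ∈ A'.states ∧ R a b ∧ b ∈ (B.desired W).states where
  mem h := h.2.2
  init a ha := by
    obtain ⟨b, hb, hab⟩ := h.init a (hA.init ha)
    have ha := A'.init_sub ha
    have hb : b ∈ (B.desired W).init := ⟨hb, hW a ha b hab⟩
    exact ⟨b, hb, ha, hab, (B.desired W).init_sub hb⟩
  step := by
    rintro a b ⟨-, hab, hb⟩ e a' hs
    obtain ⟨b', hb', hab'⟩ := h.step hab (hA.step _ _ _ hs)
    have ha' := A'.step_right hs
    have hb'' := (desired_step_iff hb).2 ⟨hb', hW a' ha' b' hab'⟩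
    exact ⟨b', hb'', ha', hab', (B.desired W).step_right hb''⟩

end Simulation

section Composition

/-- The automaton with a self-loop at each state for each event outside its alphabet. It makes the
synchronous composition a plain product, see `syncAll_step_some_iff`. -/
def selfLooped (G : Automaton E Q) : Automaton E Q where
  alphabet := Set.univ
  states := G.states
  step x l y := G.step x l y ∨ ∃ e ∉ G.alphabet, l = some e ∧ x ∈ G.states ∧ y = x
  init := G.init
  marked := G.marked
  step_left := by rintro x l y (h | ⟨e, -, -, hx, -⟩); exacts [G.step_left h, hx]
  step_right := by rintro x l y (h | ⟨e, -, -, hx, rfl⟩); exacts [G.step_right h, hx]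
  step_event _ := trivial
  init_sub := G.init_sub
  marked_sub := G.marked_sub

theorem selfLooped_step_of_mem {e : E} (he : e ∈ G.alphabet) {x y : Q} :
    G.selfLooped.step x (some e) y ↔ G.step x (some e) y := by
  simp [selfLooped, he]

theorem selfLooped_step_of_notMem {e : E} (he : e ∉ G.alphabet) {x y : Q} :
    G.selfLooped.step x (some e) y ↔ x ∈ G.states ∧ y = x := by
  have : ¬ G.step x (some e) y := fun h => he (G.step_event h)
  simp [selfLooped, he, this]

theorem selfLooped_UR (X : Set Q) : G.selfLooped.UR X = G.UR X := by
  have step {x y : Q} : G.selfLooped.step x none y ↔ G.step x none y := by simp [selfLooped]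
  ext y
  refine exists_congr fun x => and_congr_right fun _ => ⟨fun p => ?_, fun p => ?_⟩
  · exact p.silent_induction (.refl G x) fun a b h hab => h.trans (.of_step (step.1 hab))
  · exact p.silent_induction (.refl _ x) fun a b h hab => h.trans (.of_step (step.2 hab))

theorem selfLooped_nextEstimate_of_mem {e : E} (he : e ∈ G.alphabet) (X : Set Q) :
    G.selfLooped.nextEstimate X e = G.nextEstimate X e := by
  simp only [nextEstimate, selfLooped_step_of_mem he, selfLooped_UR]

theorem IsEstimate.selfLooped_nextEstimate_of_notMem {X : Set Q} (hX : G.IsEstimate X) {e : E}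
    (he : e ∉ G.alphabet) : G.selfLooped.nextEstimate X e = X := by
  simp only [Automaton.nextEstimate, selfLooped_step_of_notMem he, selfLooped_UR]
  refine subset_antisymm ?_ fun x hx => ⟨x, hx, x, ⟨hX.sub hx, rfl⟩, x, rfl, .refl G x⟩
  rintro z ⟨x, hx, _, ⟨-, rfl⟩, _, rfl, p⟩
  exact hX.closed ⟨_, hx, p⟩

variable {ι : Type*} {P : ι → Type*} {H : ∀ i, Automaton E (P i)}

theorem syncAll_step_some_iff {x y : ∀ i, P i} {e : E} :
    (syncAll H).step x (some e) y ↔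
      e ∈ (syncAll H).alphabet ∧ ∀ i, (H i).selfLooped.step (x i) (some e) (y i) := by
  constructor
  · rintro ⟨hx, -, ⟨e', he', he, h⟩ | ⟨h, -⟩⟩
    · cases he'
      refine ⟨he, fun i => ?_⟩
      by_cases hi : e ∈ (H i).alphabet
      · exact (selfLooped_step_of_mem hi).2 ((h i).1 hi)
      · exact (selfLooped_step_of_notMem hi).2 ⟨hx i, (h i).2 hi⟩
    · cases h
  · rintro ⟨he, h⟩
    refine ⟨fun i => (H i).selfLooped.step_left (h i), fun i => (H i).selfLooped.step_right (h i),
      .inl ⟨e, rfl, he, fun i => ⟨fun hi => ?_, fun hi => ?_⟩⟩⟩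
    · exact (selfLooped_step_of_mem hi).1 (h i)
    · exact ((selfLooped_step_of_notMem hi).1 (h i)).2

theorem syncAll_init (H : ∀ i, Automaton E (P i)) :
    (syncAll H).init = Set.univ.pi fun i => (H i).init := by
  ext x
  simp [syncAll]

theorem exists_syncAll_step {x : ∀ i, P i} {e : E} (he : e ∈ (syncAll H).alphabet)
    (h : ∀ i, ∃ y, (H i).selfLooped.step (x i) (some e) y) :
    ∃ y, (syncAll H).step x (some e) y := by
  choose y hy using h
  exact ⟨y, syncAll_step_some_iff.2 ⟨he, hy⟩⟩

theorem TauFree.syncAll (h : ∀ i, (H i).TauFree) : (syncAll H).TauFree := by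
  rintro x y ⟨-, -, ⟨e, he, -⟩ | ⟨-, i, hi, -⟩⟩
  · cases he
  · exact h i _ _ hi

theorem Sub.syncAll {A B : ∀ i, Automaton E (P i)} (h : ∀ i, (A i).Sub (B i)) :
    (syncAll A).Sub (syncAll B) where
  alphabet := by simp only [Automaton.syncAll, (h _).alphabet]
  states _ hx i := (h i).states (hx i)
  step := by
    rintro x l y ⟨hx, hy, hs⟩
    refine ⟨fun i => (h i).states (hx i), fun i => (h i).states (hy i), ?_⟩
    simp only [(h _).alphabet] at hs
    refine hs.imp ?_ ?_
    · rintro ⟨e, rfl, he, hs⟩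
      exact ⟨e, rfl, he, fun i => ⟨fun hi => (h i).step _ _ _ ((hs i).1 hi), (hs i).2⟩⟩
    · rintro ⟨rfl, i, hi, hs⟩
      exact ⟨rfl, i, (h i).step _ _ _ hi, hs⟩
  init _ hx i := (h i).init (hx i)
  marked _ hx i := (h i).marked (hx i)

theorem sync_step_some_iff {Q' : Type*} {K : Automaton E Q'} {x y : Q × Q'} {e : E} :
    (G.sync K).step x (some e) y ↔ e ∈ (G.sync K).alphabet ∧
      G.selfLooped.step x.1 (some e) y.1 ∧ K.selfLooped.step x.2 (some e) y.2 := by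
  have hG := fun h : G.step x.1 (some e) y.1 => And.intro (G.step_event h) (G.step_left h)
  have hK := fun h : K.step x.2 (some e) y.2 => And.intro (K.step_event h) (K.step_left h)
  simp only [sync, selfLooped, Option.some.injEq, reduceCtorEq, false_or, exists_eq_left',
    Set.mem_prod, Set.mem_union, Set.mem_inter_iff, Set.mem_sdiff]
  grind

theorem TauFree.sync {Q' : Type*} {K : Automaton E Q'} (hG : G.TauFree) (hK : K.TauFree) :
    (G.sync K).TauFree := by
  rintro x y ⟨-, ⟨e, he, -⟩ | ⟨-, h, -⟩ | ⟨-, -, h⟩⟩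
  · cases he
  · exact hG _ _ h
  · exact hK _ _ h

theorem WPath.syncAll_apply {x y : ∀ i, P i} (p : (syncAll H).WPath x [] y) (i : ι) :
    (H i).WPath (x i) [] (y i) := by
  refine p.silent_induction (P := fun z => (H i).WPath (x i) [] (z i)) (.refl _ _) ?_
  rintro a b ha ⟨-, -, ⟨e, he, -⟩ | ⟨-, j, hj, hne⟩⟩
  · cases he
  · by_cases hij : i = j
    · subst hij
      exact ha.trans (.of_step hj)
    · rwa [hne i hij]

theorem WPath.syncAll_update [DecidableEq ι] {x : ∀ i, P i} (hx : x ∈ (syncAll H).states) {i : ι}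
    {z : P i} (p : (H i).WPath (x i) [] z) :
    (syncAll H).WPath x [] (Function.update x i z) := by
  refine p.silent_induction (P := fun z => (syncAll H).WPath x [] (Function.update x i z)) ?_ ?_
  · simpa using WPath.refl (syncAll H) x
  · intro a b ha h
    have hupd := ha.mem_states hx
    refine ha.trans (.of_step (l := none) ⟨hupd, fun j => ?_, .inr ⟨rfl, i, ?_, ?_⟩⟩)
    · by_cases hj : j = i
      · subst hj
        simpa using (H j).step_right h
      · simpa [hj] using hx j
    · simpa using h
    · intro j hj
      simp [hj]

theorem WPath.syncAll [Finite ι] {x y : ∀ i, P i} (hx : x ∈ (syncAll H).states)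
    (p : ∀ i, (H i).WPath (x i) [] (y i)) : (syncAll H).WPath x [] y := by
  classical
  cases nonempty_fintype ι
  have piecewise (s : Finset ι) : (Automaton.syncAll H).WPath x [] (s.piecewise y x) := by
    induction s using Finset.induction_on with
    | empty => simpa using WPath.refl _ x
    | insert i s hi ih =>
      rw [Finset.piecewise_insert]
      refine ih.trans (.syncAll_update (ih.mem_states hx) ?_)
      simpa [hi] using p i
  simpa using piecewise Finset.univ

theorem UR_syncAll [Finite ι] {X : ∀ i, Set (P i)} (hX : ∀ i, X i ⊆ (H i).states) :
    (syncAll H).UR (Set.univ.pi X) = Set.univ.pi fun i => (H i).UR (X i) := by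
  ext y
  constructor
  · rintro ⟨x, hx, p⟩ i -
    exact ⟨x i, hx i trivial, p.syncAll_apply i⟩
  · intro hy
    choose x hx p using fun i => hy i trivial
    exact ⟨x, fun i _ => hx i, .syncAll (fun i => hX i (hx i)) p⟩

theorem nextEstimate_syncAll [Finite ι] (X : ∀ i, Set (P i)) {e : E}
    (he : e ∈ (syncAll H).alphabet) :
    (syncAll H).nextEstimate (Set.univ.pi X) e =
      Set.univ.pi fun i => (H i).selfLooped.nextEstimate (X i) e := by
  have hUR {x y : ∀ i, P i} (h : (syncAll H).step x (some e) y) :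
      (syncAll H).UR {y} = Set.univ.pi fun i => (H i).selfLooped.UR {y i} := by
    simp only [← Set.univ_pi_singleton, selfLooped_UR]
    exact UR_syncAll fun i => Set.singleton_subset_iff.2 ((syncAll H).step_right h i)
  ext z
  constructor
  · rintro ⟨x, hx, y, h, hz⟩ i -
    rw [hUR h] at hz
    exact ⟨x i, hx i trivial, y i, (syncAll_step_some_iff.1 h).2 i, hz i trivial⟩
  · intro hz
    choose x hx y h hz using fun i => hz i trivial
    have h := syncAll_step_some_iff.2 ⟨he, h⟩
    exact ⟨x, fun i _ => hx i, y, h, hUR h ▸ fun i _ => hz i⟩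

end Composition

/-! ### Abstraction of observers -/

section Abstraction

/-- Observation equivalence: equivalent states match each other's weak paths. -/
def IsObsEquiv (G : Automaton E Q) (r : Setoid Q) : Prop :=
  ∀ x₁ ∈ G.states, ∀ x₂ ∈ G.states, r x₁ x₂ →
    ∀ s y₁, G.WPath x₁ s y₁ → ∃ y₂, G.WPath x₂ s y₂ ∧ r y₁ y₂

variable {r : Setoid Q} {S : Set Q}

theorem IsOpaqueObsEquiv.isObsEquiv (hr : G.IsOpaqueObsEquiv S r) : G.IsObsEquiv r :=
  fun x₁ h₁ x₂ h₂ h => (hr x₁ h₁ x₂ h₂ h).1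

theorem IsOpaqueBisimulation.isBisimulation {r : Setoid (Set Q)}
    (hr : G.IsOpaqueBisimulation S r) : G.observer.IsBisimulation r := by
  intro X₁ h₁ X₂ h₂ h l Y₁ hY
  cases l with
  | none => exact ((observer_isDeterministic G).tauFree _ _ hY).elim
  | some e =>
    obtain ⟨Y₂, p, hY₂⟩ := (hr X₁ h₁ X₂ h₂ h).1 [e] Y₁ (.single hY)
    obtain ⟨Y, hs, p⟩ := path_cons_iff.1 p
    exact ⟨Y, hs, path_nil_iff.1 p ▸ hY₂⟩

theorem WPath.quot (r : Setoid Q) {x y : Q} {s : List E} (p : G.WPath x s y) :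
    (G.quot r).WPath (Quotient.mk r x) s (Quotient.mk r y) := by
  obtain ⟨t, rfl, p⟩ := p
  refine ⟨t, rfl, ?_⟩
  induction p with
  | nil x => exact .nil _
  | cons h _ ih => exact .cons ⟨_, _, h, rfl, rfl⟩ ih

theorem IsObsEquiv.exists_wpath (hr : G.IsObsEquiv r) {x : Q} (hx : x ∈ G.states)
    {d : Quotient r} {s : List E} (p : (G.quot r).WPath (Quotient.mk r x) s d) :
    ∃ y, G.WPath x s y ∧ Quotient.mk r y = d := by
  obtain ⟨t, rfl, p⟩ := p
  induction t generalizing x with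
  | nil => exact ⟨x, .refl G x, (path_nil_iff.1 p).symm⟩
  | cons l t ih =>
    obtain ⟨_, ⟨a, b, h, hax, rfl⟩, p⟩ := path_cons_iff.1 p
    obtain ⟨x', hx', hb⟩ := hr a (G.step_left h) x hx (Quotient.exact hax) _ _ (.of_step h)
    rw [Quotient.sound hb] at p
    obtain ⟨y, hy, hd⟩ := ih (hx'.mem_states hx) p
    exact ⟨y, by cases l <;> simpa using hx'.trans hy, hd⟩

theorem IsObsEquiv.after_image (hr : G.IsObsEquiv r) {X : Set Q} (hX : X ⊆ G.states)
    (s : List E) : (G.quot r).after (Quotient.mk r '' X) s = Quotient.mk r '' G.after X s := by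
  ext d
  constructor
  · rintro ⟨_, ⟨x, hx, rfl⟩, p⟩
    obtain ⟨y, hy, rfl⟩ := hr.exists_wpath (hX hx) p
    exact ⟨y, ⟨x, hx, hy⟩, rfl⟩
  · rintro ⟨y, ⟨x, hx, p⟩, rfl⟩
    exact ⟨_, ⟨x, hx, rfl⟩, p.quot r⟩

theorem IsObsEquiv.nextEstimate_image (hr : G.IsObsEquiv r) {X : Set Q} (hX : G.IsEstimate X)
    (e : E) :
    (G.quot r).nextEstimate (Quotient.mk r '' X) e = Quotient.mk r '' G.nextEstimate X e := by
  have himage : (G.quot r).IsEstimate (Quotient.mk r '' X) :=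
    ⟨Set.image_mono hX.sub, by rw [hr.after_image hX.sub, hX.after_nil]⟩
  rw [himage.nextEstimate_eq, hX.nextEstimate_eq, hr.after_image hX.sub]

theorem IsObsEquiv.UR_init_quot (hr : G.IsObsEquiv r) :
    (G.quot r).UR (G.quot r).init = Quotient.mk r '' G.UR G.init :=
  hr.after_image G.init_sub []

variable {ρ : Setoid (Set (Quotient r))} {X : Set Q} {c c' : Quotient ρ} {e : E}

/-- `c` is the class of the abstraction of the nonempty estimate `X` in the abstracted observer. -/
structure Abstracts (G : Automaton E Q) (r : Setoid Q) (ρ : Setoid (Set (Quotient r)))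
    (X : Set Q) (c : Quotient ρ) : Prop where
  isEstimate : G.IsEstimate X
  nonempty : X.Nonempty
  mem : Quotient.mk r '' X ∈ (G.quot r).observer.states
  eq : Quotient.mk ρ (Quotient.mk r '' X) = c

theorem Abstracts.init (hr : G.IsObsEquiv r) (hne : (G.UR G.init).Nonempty)
    (hc : c ∈ ((G.quot r).observer.quot ρ).init) : G.Abstracts r ρ (G.UR G.init) c := by
  obtain ⟨_, rfl, rfl⟩ := hc
  exact ⟨isEstimate_after G.init_sub [], hne, hr.UR_init_quot ▸ UR_init_mem_observer _,
    congrArg _ hr.UR_init_quot.symm⟩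

theorem Abstracts.step (hr : G.IsObsEquiv r) (hρ : (G.quot r).observer.IsBisimulation ρ)
    (h : G.Abstracts r ρ X c) (hs : ((G.quot r).observer.quot ρ).selfLooped.step c (some e) c') :
    G.Abstracts r ρ (G.selfLooped.nextEstimate X e) c' := by
  by_cases he : e ∈ G.alphabet
  · rw [selfLooped_nextEstimate_of_mem he]
    obtain ⟨A, B, hAB, hA, rfl⟩ :=
      (selfLooped_step_of_mem (G := (G.quot r).observer.quot ρ) he).1 hs
    obtain ⟨B', hB', hBB'⟩ := hρ A ((G.quot r).observer.step_left hAB) _ h.mem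
      (Quotient.exact (hA.trans h.eq.symm)) _ _ hAB
    have hm := (G.quot r).observer.step_right hB'
    obtain ⟨rfl, hne⟩ := (observer_step_some_iff h.mem).1 hB'
    rw [hr.nextEstimate_image h.isEstimate] at hm hne hBB'
    exact ⟨h.isEstimate.nextEstimate e, Set.image_nonempty.1 hne, hm, (Quotient.sound hBB').symm⟩
  · rw [h.isEstimate.selfLooped_nextEstimate_of_notMem he]
    rwa [((selfLooped_step_of_notMem (G := (G.quot r).observer.quot ρ) he).1 hs).2]

theorem Abstracts.exists_step (hr : G.IsObsEquiv r) (h : G.Abstracts r ρ X c)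
    (hne : (G.selfLooped.nextEstimate X e).Nonempty) :
    ∃ c', ((G.quot r).observer.quot ρ).selfLooped.step c (some e) c' := by
  by_cases he : e ∈ G.alphabet
  · rw [selfLooped_nextEstimate_of_mem he] at hne
    have hs : (G.quot r).observer.step (Quotient.mk r '' X) (some e)
        (Quotient.mk r '' G.nextEstimate X e) := by
      rw [observer_step_some_iff h.mem, hr.nextEstimate_image h.isEstimate]
      exact ⟨rfl, hne.image _⟩
    exact ⟨_, (selfLooped_step_of_mem (G := (G.quot r).observer.quot ρ) he).2 ⟨_, _, hs, h.eq, rfl⟩⟩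
  · exact ⟨c, (selfLooped_step_of_notMem (G := (G.quot r).observer.quot ρ) he).2
      ⟨⟨_, h.mem, h.eq⟩, rfl⟩⟩

/-- The states of the abstracted observer of a component that violate its opacity: the classes of
the estimates that contain only secret states. -/
abbrev abstractViolations (G : Automaton E Q) (S : Set Q) (r : Setoid Q)
    (ρ : Setoid (Set (Quotient r))) : Set (Quotient ρ) :=
  Quotient.mk ρ '' {X | X ∈ (G.quot r).observer.states ∧ X ⊆ Quotient.mk r '' S}

theorem Abstracts.not_subset (h : G.Abstracts r ρ X c) (hc : c ∉ G.abstractViolations S r ρ) :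
    ¬ X ⊆ S :=
  fun hX => hc ⟨_, ⟨h.mem, Set.image_mono hX⟩, h.eq⟩

end Abstraction

section ModularAbstraction

variable {ι : Type*} {P : ι → Type*} {H : ∀ i, Automaton E (P i)}
  {S : ∀ i, Set (P i)} {r : ∀ i, Setoid (P i)} {ρ : ∀ i, Setoid (Set (Quotient (r i)))}

/-- The estimate `Y` of the composition is the product of estimates of the components that are
abstracted to the states `c`. -/
def Represents (H : ∀ i, Automaton E (P i)) (r : ∀ i, Setoid (P i))
    (ρ : ∀ i, Setoid (Set (Quotient (r i)))) (c : ∀ i, Quotient (ρ i)) (Y : Set (∀ i, P i)) :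
    Prop :=
  Y ∈ (syncAll H).observer.states ∧
    ∃ X, Y = Set.univ.pi X ∧ ∀ i, (H i).Abstracts (r i) (ρ i) (X i) (c i)

theorem isSimulation_observer [Finite ι] (hr : ∀ i, (H i).IsObsEquiv (r i))
    (hρ : ∀ i, ((H i).quot (r i)).observer.IsBisimulation (ρ i))
    (hne : ∀ i, ((H i).UR (H i).init).Nonempty) :
    IsSimulation id (syncAll fun i => ((H i).quot (r i)).observer.quot (ρ i)) (syncAll H).observer
      (Represents H r ρ) where
  mem h := h.1
  init c hc := by
    refine ⟨_, rfl, UR_init_mem_observer _, fun i => (H i).UR (H i).init, ?_,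
      fun i => .init (hr i) (hne i) (hc i)⟩
    rw [syncAll_init, UR_syncAll fun i => (H i).init_sub]
  step := by
    rintro c _ ⟨hm, X, rfl, hX⟩ e c' h
    obtain ⟨he, h⟩ := syncAll_step_some_iff.1 h
    have hX' i := (hX i).step (hr i) (hρ i) (h i)
    have hs := (observer_step_some_iff hm).2 ⟨(nextEstimate_syncAll X he).symm,
      Set.univ_pi_nonempty_iff.2 fun i => (hX' i).nonempty⟩
    exact ⟨_, hs, (syncAll H).observer.step_right hs, _, rfl, hX'⟩

theorem Represents.exists_step [Finite ι] (hr : ∀ i, (H i).IsObsEquiv (r i))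
    {c : ∀ i, Quotient (ρ i)} {Y Y' : Set (∀ i, P i)} (h : Represents H r ρ c Y) {e : E}
    (hs : (syncAll H).observer.step Y (some e) Y') :
    ∃ c', (syncAll fun i => ((H i).quot (r i)).observer.quot (ρ i)).step c (some e) c' := by
  obtain ⟨hm, X, rfl, hX⟩ := h
  have he := (syncAll H).observer.step_event hs
  obtain ⟨rfl, hne⟩ := (observer_step_some_iff hm).1 hs
  rw [nextEstimate_syncAll X he, Set.univ_pi_nonempty_iff] at hne
  exact exists_syncAll_step he fun i => (hX i).exists_step (hr i) (hne i)

theorem not_pi_subset_modularSecret {X : ∀ i, Set (P i)} (h : ∀ i, ¬ X i ⊆ S i) :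
    ¬ Set.univ.pi X ⊆ modularSecret S := by
  choose x hx hxS using fun i => Set.not_subset.1 (h i)
  intro hX
  obtain ⟨i, hi⟩ := hX fun i _ => hx i
  exact hxS i hi

theorem exists_isSimulation_desired [Finite ι] (hr : ∀ i, (H i).IsObsEquiv (r i))
    (hρ : ∀ i, ((H i).quot (r i)).observer.IsBisimulation (ρ i))
    (hne : ∀ i, ((H i).UR (H i).init).Nonempty) (S : ∀ i, Set (P i)) :
    ∃ R, IsSimulation id
      (syncAll fun i => (((H i).quot (r i)).observer.quot (ρ i)).desired
        ((H i).abstractViolations (S i) (r i) (ρ i)))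
      ((syncAll H).observer.desired {X | X ⊆ modularSecret S}) R := by
  refine ⟨_, (isSimulation_observer hr hρ hne).desired (.syncAll fun i => desired_sub _ _) ?_⟩
  rintro c hc _ ⟨-, X, rfl, hX⟩
  exact not_pi_subset_modularSecret fun i => (hX i).not_subset (hc i).1.2

end ModularAbstraction

end Automaton

/-! ### Edit functions and three-player observers -/

section EditFunctions

variable {E : Type*}

theorem runWord_append (v w : List (Round E)) : runWord (v ++ w) = runWord v ++ runWord w :=
  List.flatMap_append

theorem runString_append (v w : List (Round E)) :
    runString (v ++ w) = runString v ++ runString w :=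
  List.flatMap_append

theorem editProj_append (v w : List (Round E)) : editProj (v ++ w) = editProj v ++ editProj w :=
  List.map_append

/-- A rule that continues a sequence of rounds by a round for the next event. -/
abbrev RoundStrategy (E : Type*) := List (Round E) → E → Round E

namespace RoundStrategy

variable {next : RoundStrategy E}

/-- The sequence of rounds that answers the string `s`. -/
def run (next : RoundStrategy E) (s : List E) : List (Round E) :=
  s.foldl (fun v e => v ++ [next v e]) []

/-- The edit function that outputs the rounds of the strategy. -/
def editFunction (next : RoundStrategy E) : EditFunction E :=
  fun s e => (next (next.run s) e).output

theorem run_snoc (next : RoundStrategy E) (s : List E) (e : E) :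
    next.run (s ++ [e]) = next.run s ++ [next (next.run s) e] := by
  simp [run]

theorem editProj_run (hnext : ∀ v e, (next v e).event = e) (s : List E) :
    editProj (next.run s) = s := by
  induction s using List.reverseRecOn with
  | nil => rfl
  | append_singleton s e ih =>
    rw [run_snoc, editProj_append, ih]
    simp [editProj, hnext]

theorem runString_run (next : RoundStrategy E) (s : List E) :
    runString (next.run s) = next.editFunction.output s := by
  induction s using List.reverseRecOn with
  | nil => rfl
  | append_singleton s e ih =>
    rw [run_snoc, runString_append, ih, EditFunction.output_snoc]
    simp [editFunction, runString]

theorem run_editProj {ω : List (Round E)} (hω : ∀ v c, v ++ [c] <+: ω → next v c.event = c) :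
    next.run (editProj ω) = ω := by
  suffices h : ∀ v, v <+: ω → next.run (editProj v) = v from h ω List.prefix_rfl
  intro v hv
  induction v using List.reverseRecOn with
  | nil => rfl
  | append_singleton v c ih =>
    have hc : editProj [c] = [c.event] := rfl
    rw [editProj_append, hc, run_snoc, ih ((List.prefix_append _ _).trans hv), hω v c hv]

end RoundStrategy

theorem eq_of_prefix_snoc {α : Type*} {v w : List α} {a b : α} (ha : v ++ [a] <+: w)
    (hb : v ++ [b] <+: w) : a = b := by
  simpa using (List.prefix_of_prefix_length_le ha hb (by simp)).eq_of_length (by simp)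

theorem exists_roundStrategy {P : List (Round E) → Prop} {L : Set (List E)} {ω : List (Round E)}
    (hω : ∀ v, v <+: ω → P v)
    (hext : ∀ v e, P v → editProj v ++ [e] ∈ L → ∃ c : Round E, c.event = e ∧ P (v ++ [c])) :
    ∃ next : RoundStrategy E, (∀ v e, (next v e).event = e) ∧
      (∀ v c, v ++ [c] <+: ω → next v c.event = c) ∧
      ∀ v e, P v → editProj v ++ [e] ∈ L → P (v ++ [next v e]) := by
  have hround (v : List (Round E)) (e : E) : ∃ c : Round E, c.event = e ∧
      (∀ c', v ++ [c'] <+: ω → c'.event = e → c = c') ∧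
      (P v → editProj v ++ [e] ∈ L → P (v ++ [c])) := by
    by_cases hc : ∃ c : Round E, v ++ [c] <+: ω ∧ c.event = e
    · obtain ⟨c, hc, rfl⟩ := hc
      exact ⟨c, rfl, fun c' hc' _ => eq_of_prefix_snoc hc hc', fun _ _ => hω _ hc⟩
    · have hnone c (h : v ++ [c] <+: ω) (he : c.event = e) : False := hc ⟨c, h, he⟩
      by_cases hv : P v ∧ editProj v ++ [e] ∈ L
      · obtain ⟨c, rfl, hPc⟩ := hext v e hv.1 hv.2
        exact ⟨c, rfl, fun c' h he => (hnone c' h he).elim, fun _ _ => hPc⟩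
      · exact ⟨⟨e, [], false⟩, rfl, fun c' h he => (hnone c' h he).elim,
          fun h h' => (hv ⟨h, h'⟩).elim⟩
  choose next hevent hfollow hP using hround
  exact ⟨next, hevent, fun v c h => hfollow v _ c h rfl, hP⟩

theorem exists_editFunction {P : List (Round E) → Prop} {L : Set (List E)}
    (hL : ∀ s t, s ++ t ∈ L → s ∈ L) (hpre : ∀ v w, P (v ++ w) → P v)
    (hext : ∀ v e, P v → editProj v ++ [e] ∈ L → ∃ c : Round E, c.event = e ∧ P (v ++ [c]))
    {ω : List (Round E)} (hω : P ω) :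
    ∃ f : EditFunction E, (∀ s ∈ L, ∃ v, P v ∧ editProj v = s ∧ runString v = f.output s) ∧
      runString ω = f.output (editProj ω) := by
  obtain ⟨next, hevent, hfollow, hP⟩ :=
    exists_roundStrategy (ω := ω) (by rintro v ⟨w, rfl⟩; exact hpre v w hω) hext
  have hrun (s : List E) (hs : s ∈ L) : P (next.run s) := by
    induction s using List.reverseRecOn with
    | nil => exact hpre [] ω hω
    | append_singleton s e ih =>
      rw [next.run_snoc]
      refine hP _ e (ih (hL s [e] hs)) ?_
      rwa [RoundStrategy.editProj_run hevent]
  refine ⟨next.editFunction, fun s hs => ⟨next.run s, hrun s hs,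
    RoundStrategy.editProj_run hevent s, next.runString_run s⟩, ?_⟩
  rw [← next.runString_run, RoundStrategy.run_editProj hfollow]

end EditFunctions

section Runs

open Automaton

variable {E XD XF : Type*} {D : Automaton E XD} {F : Automaton E XF}
  {p q : TState E XD XF} {d : XD} {f : XF} {e : E}

theorem largestTPO_step_some_iff {a : Label E} :
    (largestTPO D F).step p (some a) q ↔ p ∈ tpoStates D F ∧ q ∈ tpoStates D F ∧
      a ∈ labels F.alphabet ∧ Admissible D F p a q := by
  simp [largestTPO]

theorem Admissible.mem_tpoStates {a : Label E} (h : Admissible D F p a q)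
    (hp : p ∈ tpoStates D F) : q ∈ tpoStates D F := by
  cases h with
  | yz hf => exact ⟨hp.1, hp.2, F.step_event hf⟩
  | zz hd => exact ⟨D.step_right hd, hp.2⟩
  | zw1 | zw2 => exact hp
  | wy1 hd hf => exact ⟨D.step_right hd, F.step_right hf⟩
  | wy2 hf => exact ⟨hp.1, F.step_right hf⟩

theorem largestTPO_path_insertions {θ : List E}
    (h : (largestTPO D F).Path (.z d f e) ((θ.map Label.ev).map some) q) :
    ∃ d', q = .z d' f e := by
  induction θ generalizing d with
  | nil => exact ⟨d, path_nil_iff.1 h⟩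
  | cons e' θ ih =>
    obtain ⟨p, h, hθ⟩ := path_cons_iff.1 h
    cases (largestTPO_step_some_iff.1 h).2.2.2
    exact ih hθ

theorem largestTPO_path_word {c : Round E}
    (h : (largestTPO D F).Path (.y d f) (c.word.map some) q) :
    ∃ d' f', q = .y d' f' ∧ F.step f (some c.event) f' := by
  rw [Round.word, List.map_cons, List.map_append, path_cons_iff] at h
  obtain ⟨p, h, hround⟩ := h
  cases (largestTPO_step_some_iff.1 h).2.2.2
  obtain ⟨p, h, hdecision⟩ := path_append_iff.1 hround
  obtain ⟨d', rfl⟩ := largestTPO_path_insertions h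
  obtain ⟨p, h, hevent⟩ := path_cons_iff.1 hdecision
  obtain ⟨p', h', hnil⟩ := path_cons_iff.1 hevent
  obtain rfl := path_nil_iff.1 hnil
  have h := (largestTPO_step_some_iff.1 h).2.2.2
  have h' := (largestTPO_step_some_iff.1 h').2.2.2
  rcases c with ⟨e, θ, _ | _⟩ <;> cases h <;> cases h' <;> exact ⟨_, _, rfl, ‹_›⟩

theorem largestTPO_path_runWord {ω : List (Round E)}
    (h : (largestTPO D F).Path (.y d f) ((runWord ω).map some) q) :
    ∃ d' f', q = .y d' f' ∧ F.Path f ((editProj ω).map some) f' := by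
  induction ω generalizing d f with
  | nil => exact ⟨d, f, path_nil_iff.1 h, .nil f⟩
  | cons c ω ih =>
    rw [runWord, List.flatMap_cons, List.map_append, path_append_iff] at h
    obtain ⟨p, h, hω⟩ := h
    obtain ⟨d₁, f₁, rfl, hf⟩ := largestTPO_path_word h
    obtain ⟨d', f', rfl, hpath⟩ := ih hω
    exact ⟨d', f', rfl, .cons hf hpath⟩

/-- The label sequences that complete the current round and continue with rounds. -/
def CompletesRuns : TState E XD XF → List (Label E) → Prop
  | .y _ _, w => ∃ ω, w = runWord ω
  | .z _ _ e, w => ∃ (θ : List E) (b : Bool) (ω : List (Round E)),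
      w = θ.map .ev ++ ([if b then .erase e else .eps, .ev e] ++ runWord ω)
  | .w _ _ a, w => ∃ ω, w = .ev a.event :: runWord ω

theorem CompletesRuns.cons {a : Label E} {w : List (Label E)}
    (h : Admissible D F p a q) (hw : CompletesRuns q w) : CompletesRuns p (a :: w) := by
  cases h with
  | @yz _ _ e =>
    obtain ⟨θ, b, ω, rfl⟩ := hw
    exact ⟨⟨e, θ, b⟩ :: ω, by simp [runWord, Round.word]⟩
  | @zz _ _ _ θ₀ =>
    obtain ⟨θ, b, ω, rfl⟩ := hw
    exact ⟨θ₀ :: θ, b, ω, rfl⟩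
  | zw1 =>
    obtain ⟨ω, rfl⟩ := hw
    exact ⟨[], false, ω, rfl⟩
  | zw2 =>
    obtain ⟨ω, rfl⟩ := hw
    exact ⟨[], true, ω, rfl⟩
  | wy1 =>
    obtain ⟨ω, rfl⟩ := hw
    exact ⟨ω, rfl⟩
  | wy2 =>
    obtain ⟨ω, rfl⟩ := hw
    exact ⟨ω, rfl⟩

theorem completesRuns_of_path {w : List (Label E)} (hq : q.IsY)
    (h : (largestTPO D F).Path p (w.map some) q) : CompletesRuns p w := by
  induction w generalizing p with
  | nil =>
    obtain rfl := path_nil_iff.1 h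
    cases q with
    | y d f => exact ⟨[], rfl⟩
    | z => exact hq.elim
    | w => exact hq.elim
  | cons a w ih =>
    obtain ⟨p', h, hw⟩ := path_cons_iff.1 h
    exact (ih hw).cons (largestTPO_step_some_iff.1 h).2.2.2

theorem constrained_path {n : ℕ} {T : Automaton (Label E) (TState E XD XF)}
    {p q : TState E XD XF × ℕ} {t : List (Option (Label E))}
    (h : (constrained n T).Path p t q) : T.Path p.1 t q.1 := by
  induction h with
  | nil p => exact .nil p.1
  | cons h _ ih => exact .cons h.1 ih

end Runs

section Functoriality

open Automaton

variable {E XD XF XD' XF' : Type*} {D : Automaton E XD} {F : Automaton E XF}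
  {D' : Automaton E XD'} {F' : Automaton E XF'} {RD : XD → XD' → Prop} {RF : XF → XF' → Prop}

/-- Two states of three-player observers are of the same kind, with the same event or action, and
their components are related. -/
inductive TState.Lift (RD : XD → XD' → Prop) (RF : XF → XF' → Prop) :
    TState E XD XF → TState E XD' XF' → Prop
  | y {d f d' f'} : RD d d' → RF f f' → TState.Lift RD RF (.y d f) (.y d' f')
  | z {d f d' f' e} : RD d d' → RF f f' → TState.Lift RD RF (.z d f e) (.z d' f' e)
  | w {d f d' f' a} : RD d d' → RF f f' → TState.Lift RD RF (.w d f a) (.w d' f' a)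

theorem TState.Lift.exists_admissible (hD : IsSimulation id D D' RD)
    (hF : IsSimulation id F F' RF) {p q : TState E XD XF} {p' : TState E XD' XF'} {a : Label E}
    (hp : TState.Lift RD RF p p') (h : Admissible D F p a q) :
    ∃ q', Admissible D' F' p' a q' ∧ TState.Lift RD RF q q' := by
  cases h with
  | yz hf =>
    cases hp with | y rd rf =>
    obtain ⟨f', hf', -⟩ := hF.step rf hf
    exact ⟨_, .yz hf', .z rd rf⟩
  | zz hd =>
    cases hp with | z rd rf =>
    obtain ⟨d', hd', rd'⟩ := hD.step rd hd
    exact ⟨_, .zz hd', .z rd' rf⟩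
  | zw1 hd hf =>
    cases hp with | z rd rf =>
    obtain ⟨d', hd', -⟩ := hD.step rd hd
    obtain ⟨f', hf', -⟩ := hF.step rf hf
    exact ⟨_, .zw1 hd' hf', .w rd rf⟩
  | zw2 hf =>
    cases hp with | z rd rf =>
    obtain ⟨f', hf', -⟩ := hF.step rf hf
    exact ⟨_, .zw2 hf', .w rd rf⟩
  | wy1 hd hf =>
    cases hp with | w rd rf =>
    obtain ⟨d', hd', rd'⟩ := hD.step rd hd
    obtain ⟨f', hf', rf'⟩ := hF.step rf hf
    exact ⟨_, .wy1 hd' hf', .y rd' rf'⟩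
  | wy2 hf =>
    cases hp with | w rd rf =>
    obtain ⟨f', hf', rf'⟩ := hF.step rf hf
    exact ⟨_, .wy2 hf', .y rd rf'⟩

theorem TState.Lift.mem_tpoStates (hD : IsSimulation id D D' RD) (hF : IsSimulation id F F' RF)
    (hA : F.alphabet = F'.alphabet) {p : TState E XD XF} {p' : TState E XD' XF'}
    (hp : TState.Lift RD RF p p') (h : p ∈ tpoStates D F) : p' ∈ tpoStates D' F' := by
  cases hp with
  | y rd rf => exact ⟨hD.mem rd, hF.mem rf⟩
  | z rd rf => exact ⟨hD.mem rd, hF.mem rf, hA ▸ h.2.2⟩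
  | w rd rf => exact ⟨hD.mem rd, hF.mem rf, hA ▸ h.2.2⟩

theorem erasureCount_eq_of_lift {p : TState E XD XF} {p' : TState E XD' XF'}
    (hp : TState.Lift RD RF p p') (a : Label E) (k : ℕ) :
    erasureCount p' a k = erasureCount p a k := by
  cases hp <;> cases a <;> rfl

theorem Automaton.IsSimulation.largestTPO (hD : IsSimulation id D D' RD)
    (hF : IsSimulation id F F' RF) (hA : F.alphabet = F'.alphabet) :
    IsSimulation id (largestTPO D F) (largestTPO D' F') fun p p' =>
      p ∈ tpoStates D F ∧ TState.Lift RD RF p p' where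
  mem h := h.2.mem_tpoStates hD hF hA h.1
  init := by
    rintro _ ⟨d, hd, f, hf, rfl⟩
    obtain ⟨d', hd', rd⟩ := hD.init d hd
    obtain ⟨f', hf', rf⟩ := hF.init f hf
    exact ⟨_, ⟨d', hd', f', hf', rfl⟩, ⟨D.init_sub hd, F.init_sub hf⟩, .y rd rf⟩
  step := by
    rintro p p' ⟨hm, hp⟩ a q h
    obtain ⟨-, hq, ha, h⟩ := largestTPO_step_some_iff.1 h
    obtain ⟨q', h', hqq'⟩ := hp.exists_admissible hD hF h
    exact ⟨q', largestTPO_step_some_iff.2 ⟨hp.mem_tpoStates hD hF hA hm,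
      hqq'.mem_tpoStates hD hF hA hq, hA ▸ ha, h'⟩, hq, hqq'⟩

theorem Automaton.IsSimulation.constrained {T : Automaton (Label E) (TState E XD XF)}
    {T' : Automaton (Label E) (TState E XD' XF')} {R : TState E XD XF → TState E XD' XF' → Prop}
    (h : IsSimulation id T T' R)
    (hR : ∀ p p' a k, R p p' → erasureCount p' a k = erasureCount p a k) (n : ℕ) :
    IsSimulation id (constrained n T) (constrained n T') fun p p' =>
      R p.1 p'.1 ∧ p.2 = p'.2 ∧ p.2 ≤ n where
  mem hp := ⟨h.mem hp.1, hp.2.1 ▸ hp.2.2⟩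
  init p hp := by
    obtain ⟨p', hp', hpp'⟩ := h.init p.1 hp.1
    exact ⟨(p', p.2), ⟨hp', hp.2⟩, hpp', rfl, hp.2.trans_le n.zero_le⟩
  step := by
    rintro ⟨p, k⟩ ⟨p', _⟩ ⟨hpp', rfl, hk⟩ a ⟨q, k'⟩ ⟨hs, -, hk', _, ⟨⟩, hc⟩
    obtain ⟨q', hs', hqq'⟩ := h.step hpp' hs
    exact ⟨(q', k'), ⟨hs', hk, hk', a, rfl, hc.trans (hR p p' a k hpp').symm⟩, hqq', rfl, hk'⟩

end Functoriality

/-! ### Supervisors of edit decisions -/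

section Supervision

open Automaton

variable {E XD XF Ev X : Type*} {n : ℕ} {D : Automaton E XD} {F : Automaton E XF}
  {φ : Ev → Label E} {Sup : Automaton Ev X} {R : X → TState E XD XF × ℕ → Prop}
  {v w : List (Round E)} {x y : X} {d : XD} {f f' : XF} {k : ℕ} {e : E} {t : List Ev}

/-- The rounds `v` are, up to the relabelling `φ`, a behaviour of `Sup`. -/
def IsSupervised (φ : Ev → Label E) (Sup : Automaton Ev X) (v : List (Round E)) : Prop :=
  ∃ t ∈ Sup.lang, runWord v = t.map φ

/-- The rounds `v` are, up to the relabelling `φ`, a behaviour of `Sup` that ends in `x`. -/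
def LeadsTo (φ : Ev → Label E) (Sup : Automaton Ev X) (v : List (Round E)) (x : X) : Prop :=
  ∃ x₀ ∈ Sup.init, ∃ t : List Ev, runWord v = t.map φ ∧ Sup.Path x₀ (t.map some) x

theorem isSupervised_iff_exists_leadsTo (hSup : Sup.TauFree) :
    IsSupervised φ Sup v ↔ ∃ x, LeadsTo φ Sup v x := by
  constructor
  · rintro ⟨t, ⟨x₀, hx₀, x, p⟩, ht⟩
    exact ⟨x, x₀, hx₀, t, ht, (wpath_iff_path hSup).1 p⟩
  · rintro ⟨x, x₀, hx₀, t, ht, p⟩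
    exact ⟨t, ⟨x₀, hx₀, x, p.wpath⟩, ht⟩

theorem LeadsTo.append (h : LeadsTo φ Sup v x) (ht : runWord w = t.map φ)
    (p : Sup.Path x (t.map some) y) : LeadsTo φ Sup (v ++ w) y := by
  obtain ⟨x₀, hx₀, s, hs, q⟩ := h
  refine ⟨x₀, hx₀, s ++ t, by rw [runWord_append, hs, ht, List.map_append], ?_⟩
  rw [List.map_append]
  exact q.append p

theorem LeadsTo.of_append (h : LeadsTo φ Sup (v ++ w) y) : ∃ x, LeadsTo φ Sup v x := by
  obtain ⟨x₀, hx₀, t, ht, p⟩ := h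
  rw [runWord_append] at ht
  obtain ⟨t₁, t₂, rfl, ht₁, -⟩ := List.map_eq_append_iff.1 ht.symm
  rw [List.map_append] at p
  obtain ⟨x, p, -⟩ := path_append_iff.1 p
  exact ⟨x, x₀, hx₀, t₁, ht₁.symm, p⟩

theorem constrained_step_unique {p q q' : TState E XD XF × ℕ} {l : Option (Label E)}
    (hp : p.1.IsY) (h : (constrained n (largestTPO D F)).step p l q)
    (h' : (constrained n (largestTPO D F)).step p l q') : q = q' := by
  obtain ⟨p, k⟩ := p
  obtain ⟨q, k₁⟩ := q
  obtain ⟨q', k₂⟩ := q'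
  obtain ⟨⟨-, -, a, -, rfl, h⟩, -, -, _, ⟨⟩, rfl⟩ := h
  obtain ⟨⟨-, -, _, -, ⟨⟩, h'⟩, -, -, _, ⟨⟩, rfl⟩ := h'
  dsimp only at h h'
  cases h with
  | yz => cases h'; rfl
  | _ => exact hp.elim

/-- The automaton `Sup`, whose events stand for the labels of a three-player observer through `φ`
and whose states represent those of the constrained largest three-player observer through `R`, is
nonblocking, accepts only in `Y` states, and disables no output of the system. -/
structure IsEditSupervisor (n : ℕ) (D : Automaton E XD) (F : Automaton E XF) (φ : Ev → Label E)
    (Sup : Automaton Ev X) (R : X → TState E XD XF × ℕ → Prop) : Prop where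
  deterministic : F.IsDeterministic
  tauFree : Sup.TauFree
  sim : IsSimulation φ Sup (constrained n (largestTPO D F)) R
  coreachable : ∀ x ∈ Sup.states, Sup.Coreachable x
  isY_of_marked : ∀ {x p}, x ∈ Sup.marked → R x p → p.1.IsY
  enabled : ∀ {x d f k e f'}, x ∈ Sup.states → R x (.y d f, k) → F.step f (some e) f' →
    ∃ u x', φ u = .ev e ∧ Sup.step x (some u) x'

namespace IsEditSupervisor

variable (h : IsEditSupervisor n D F φ Sup R)

include h

theorem exists_marked_path (hx : x ∈ Sup.states) :
    ∃ y ∈ Sup.marked, ∃ t : List Ev, Sup.Path x (t.map some) y := by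
  obtain ⟨y, hy, t, p⟩ := h.coreachable x hx
  exact ⟨y, hy, t.reduceOption, by rwa [p.map_some_reduceOption h.tauFree]⟩

theorem completesRuns {p : TState E XD XF × ℕ} (hxp : R x p) (hy : y ∈ Sup.marked)
    (hpath : Sup.Path x (t.map some) y) : CompletesRuns p.1 (t.map φ) := by
  obtain ⟨q, hq, hyq⟩ := h.sim.path hxp hpath
  exact completesRuns_of_path (h.isY_of_marked hy hyq) (constrained_path hq)

theorem exists_runWord_of_mem_markedLang (ht : t ∈ Sup.markedLang) :
    ∃ ω, runWord ω = t.map φ := by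
  obtain ⟨x, hx, y, hy, p⟩ := ht
  obtain ⟨⟨_, _⟩, ⟨⟨d, -, f, -, rfl⟩, -⟩, hxp⟩ := h.sim.init x hx
  obtain ⟨ω, hω⟩ := h.completesRuns hxp hy ((wpath_iff_path h.tauFree).1 p)
  exact ⟨ω, hω.symm⟩

theorem exists_related_of_leadsTo (hv : LeadsTo φ Sup v x) :
    x ∈ Sup.states ∧ ∃ d f k, R x (.y d f, k) ∧
      (∃ p ∈ (simulatedPart Sup (constrained n (largestTPO D F)) R).init,
        (simulatedPart Sup (constrained n (largestTPO D F)) R).Path p ((runWord v).map some)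
          (.y d f, k)) ∧
      ∃ f₀ ∈ F.init, F.Path f₀ ((editProj v).map some) f := by
  obtain ⟨x₀, hx₀, t, ht, p⟩ := hv
  obtain ⟨⟨p₀, k₀⟩, hp₀, hxp₀⟩ := h.sim.simulatedPart.init x₀ hx₀
  obtain ⟨⟨q, k⟩, hq, hx, hxq⟩ := h.sim.simulatedPart.path hxp₀ p
  rw [← ht] at hq
  obtain ⟨d₀, -, f₀, hf₀, rfl⟩ := hp₀.1.1
  obtain ⟨d, f, rfl, hf⟩ :=
    largestTPO_path_runWord (constrained_path (hq.mono (remove_sub _ _).step))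
  exact ⟨hx, d, f, k, hxq, ⟨_, hp₀, hq⟩, f₀, hf₀, hf⟩

theorem editProj_mem_lang (hv : IsSupervised φ Sup v) : editProj v ∈ F.lang := by
  obtain ⟨x, hv⟩ := (isSupervised_iff_exists_leadsTo h.tauFree).1 hv
  obtain ⟨-, _, f, _, -, -, f₀, hf₀, hf⟩ := h.exists_related_of_leadsTo hv
  exact ⟨f₀, hf₀, f, hf.wpath⟩

theorem hasRun_simulatedPart (hv : IsSupervised φ Sup v) :
    HasRun (simulatedPart Sup (constrained n (largestTPO D F)) R) v := by
  obtain ⟨x, hv⟩ := (isSupervised_iff_exists_leadsTo h.tauFree).1 hv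
  obtain ⟨-, _, _, _, -, ⟨p, hp, hpath⟩, -⟩ := h.exists_related_of_leadsTo hv
  exact ⟨p, hp, (.y _ _, _), trivial, hpath⟩

theorem exists_round (hx : x ∈ Sup.states) (hxp : R x (.y d f, k)) (hf : F.step f (some e) f') :
    ∃ (c : Round E) (t : List Ev) (y : X),
      c.event = e ∧ c.word = t.map φ ∧ Sup.Path x (t.map some) y := by
  obtain ⟨u, x', hu, hx'⟩ := h.enabled hx hxp hf
  obtain ⟨y, hy, t, p⟩ := h.exists_marked_path (Sup.step_right hx')
  have hpath : Sup.Path x ((u :: t).map some) y := .cons hx' p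
  obtain ⟨ω, hω⟩ := h.completesRuns hxp hy hpath
  cases ω with
  | nil => simp [runWord] at hω
  | cons c ω =>
    have hword : (u :: t).map φ = c.word ++ runWord ω := hω
    have hevent : φ u = .ev c.event := (List.cons.inj hword).1
    obtain ⟨t₁, t₂, ht, hc, -⟩ := List.map_eq_append_iff.1 hword
    rw [ht, List.map_append] at hpath
    obtain ⟨z, hz, -⟩ := path_append_iff.1 hpath
    exact ⟨c, t₁, z, (Label.ev.inj (hu.symm.trans hevent)).symm, hc.symm, hz⟩

theorem exists_extension (hv : IsSupervised φ Sup v) (he : editProj v ++ [e] ∈ F.lang) :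
    ∃ c : Round E, c.event = e ∧ IsSupervised φ Sup (v ++ [c]) := by
  obtain ⟨x, hv⟩ := (isSupervised_iff_exists_leadsTo h.tauFree).1 hv
  obtain ⟨hx, d, f, k, hxp, -, f₀, hf₀, hf⟩ := h.exists_related_of_leadsTo hv
  obtain ⟨f', hf'⟩ := h.deterministic.exists_step_of_mem_lang hf₀ hf he
  obtain ⟨c, t, y, hc, ht, p⟩ := h.exists_round hx hxp hf'
  have hword : runWord [c] = t.map φ := by simpa [runWord] using ht
  exact ⟨c, hc, (isSupervised_iff_exists_leadsTo h.tauFree).2 ⟨y, hv.append hword p⟩⟩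

theorem exists_editFunction (hv : IsSupervised φ Sup v) :
    ∃ g : EditFunction E,
      (∀ s ∈ F.lang, ∃ w, IsSupervised φ Sup w ∧ editProj w = s ∧ runString w = g.output s) ∧
      runString v = g.output (editProj v) := by
  refine _root_.exists_editFunction (fun s t => lang_prefix_closed) (fun v w hvw => ?_)
    (fun v e => h.exists_extension) hv
  rw [isSupervised_iff_exists_leadsTo h.tauFree] at hvw ⊢
  exact hvw.choose_spec.of_append

theorem exists_simulatedPart_step {p : TState E XD XF × ℕ}
    (hp : p ∈ (simulatedPart Sup (constrained n (largestTPO D F)) R).states) (hY : ¬ p.1.IsY) :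
    ∃ l q, (simulatedPart Sup (constrained n (largestTPO D F)) R).step p l q := by
  obtain ⟨x, hx, hxp⟩ := exists_of_mem_simulatedPart hp
  obtain ⟨y, hy, t, hpath⟩ := h.exists_marked_path hx
  cases t with
  | nil =>
    obtain rfl := path_nil_iff.1 hpath
    exact (hY (h.isY_of_marked hy hxp)).elim
  | cons u t =>
    obtain ⟨x', hx', -⟩ := path_cons_iff.1 hpath
    obtain ⟨q, hq, -⟩ := h.sim.simulatedPart.step ⟨hx, hxp⟩ hx'
    exact ⟨_, q, hq⟩

theorem simulatedPart_step_of_isY {p q : TState E XD XF × ℕ} {l : Option (Label E)}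
    (hp : p ∈ (simulatedPart Sup (constrained n (largestTPO D F)) R).states) (hY : p.1.IsY)
    (hstep : (constrained n (largestTPO D F)).step p l q) :
    (simulatedPart Sup (constrained n (largestTPO D F)) R).step p l q := by
  obtain ⟨x, hx, hxp⟩ := exists_of_mem_simulatedPart hp
  have ⟨⟨_, _, a, _, hl, ha⟩, _⟩ := hstep
  obtain ⟨⟨d, f⟩ | _ | _, k⟩ := p
  case z | w => exact hY.elim
  obtain ⟨q, k'⟩ := q
  dsimp only at ha
  cases ha with | yz hf =>
  obtain ⟨u, x', hu, hx'⟩ := h.enabled hx hxp hf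
  obtain ⟨q', hq', -⟩ := h.sim.simulatedPart.step ⟨hx, hxp⟩ hx'
  rw [hu, ← hl] at hq'
  rwa [constrained_step_unique hY hstep ((remove_sub _ _).step _ _ _ hq')]

theorem simulatedPart_mem_completeTPOs (hv : IsSupervised φ Sup v) :
    simulatedPart Sup (constrained n (largestTPO D F)) R ∈ completeTPOs n D F F.lang := by
  have not_isY {p : TState E XD XF} (hp : p.IsZ ∨ p.IsW) : ¬ p.IsY := by
    cases p <;> simp_all [TState.IsY, TState.IsZ, TState.IsW]
  refine ⟨remove_sub _ _, fun p hp hz => ?_, fun p hp hw => ?_, fun p hp hY l q hstep => ?_,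
    fun s hs => ?_⟩
  · exact h.exists_simulatedPart_step hp (not_isY (.inl hz))
  · exact h.exists_simulatedPart_step hp (not_isY (.inr hw))
  · exact h.simulatedPart_step_of_isY hp hY hstep
  · obtain ⟨g, hg, -⟩ := h.exists_editFunction hv
    obtain ⟨w, hw, hws, -⟩ := hg s hs
    exact ⟨w, h.hasRun_simulatedPart hw, hws⟩

theorem hasRun_allEditStructure (hv : IsSupervised φ Sup v) :
    HasRun (allEditStructure n D F F.lang) v := by
  have hmem := h.simulatedPart_mem_completeTPOs hv
  have hsub := (allEditStructure_isGreatest n D F F.lang ⟨_, hmem⟩).2 _ hmem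
  obtain ⟨p, hp, q, hq, hpath⟩ := h.hasRun_simulatedPart hv
  exact ⟨p, hsub.init hp, q, hq, hpath.mono hsub.step⟩

end IsEditSupervisor

end Supervision

/-! ### Transformed automata -/

section Transformed

open Automaton

section States

variable {E XD XF YD YF : Type*}

/-- The image of a state of a three-player observer under maps of its two observer components. -/
def TState.map (g : XD → YD) (h : XF → YF) : TState E XD XF → TState E YD YF
  | .y d f => .y (g d) (h f)
  | .z d f e => .z (g d) (h f) e
  | .w d f a => .w (g d) (h f) a

open Classical in
/-- The state of a component with alphabet `A` while the system is in the given state: the component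
waits in a `Y` state during the rounds of events outside `A`. -/
noncomputable def TState.restrict (A : Set E) : TState E XD XF → TState E XD XF
  | .y d f => .y d f
  | .z d f e => if e ∈ A then .z d f e else .y d f
  | .w d f a => if a.event ∈ A then .w d f a else .y d f

theorem TState.restrict_z_of_mem {A : Set E} {e : E} (he : e ∈ A) (d : XD) (f : XF) :
    (TState.z d f e).restrict A = .z d f e :=
  if_pos he

theorem TState.restrict_z_of_notMem {A : Set E} {e : E} (he : e ∉ A) (d : XD) (f : XF) :
    (TState.z d f e).restrict A = .y d f :=
  if_neg he

theorem TState.restrict_w_of_mem {A : Set E} {a : WAction E} (ha : a.event ∈ A) (d : XD) (f : XF) :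
    (TState.w d f a).restrict A = .w d f a :=
  if_pos ha

theorem TState.restrict_w_of_notMem {A : Set E} {a : WAction E} (ha : a.event ∉ A)
    (d : XD) (f : XF) : (TState.w d f a).restrict A = .y d f :=
  if_neg ha

theorem TState.restrict_eq_or_isY (A : Set E) (p : TState E XD XF) :
    p.restrict A = p ∨ (p.restrict A).IsY := by
  unfold TState.restrict
  grind [TState.IsY]

/-- The number of consecutive erasures after an event, if it is `k` before. -/
def TEvent.erasures : TEvent E → ℕ → ℕ
  | .dec (.erase _) _, k => k + 1
  | .dec _ _, _ => 0
  | _, k => k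

/-- The events that belong to the transitions from a state of a three-player observer of a system
whose components have the alphabets `A`. A component that knows the event of the round inserts
only its own events. -/
inductive TEvent.Fits {ι : Type*} (A : ι → Set E) : TState E XD XF → TEvent E → Prop
  | plain {d f e i} : e ∈ A i → Fits A (.y d f) (.plain e)
  | insert {d f e σ i} : e ∈ A i → σ ∈ A i → Fits A (.z d f e) (.dec (.ev σ) e)
  | keep {d f e i} : e ∈ A i → Fits A (.z d f e) (.dec .eps e)
  | erase {d f e i} : e ∈ A i → Fits A (.z d f e) (.dec (.erase e) e)
  | act {d f a i} : a.event ∈ A i → Fits A (.w d f a) (.env a.event a)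

variable {ι : Type*} {A : ι → Set E} {p : TState E XD XF} {u : TEvent E}

theorem TEvent.fits_map_iff {g : XD → YD} {h : XF → YF} : u.Fits A (p.map g h) ↔ u.Fits A p := by
  constructor <;> intro hu <;> cases p <;> cases hu
  all_goals first
    | exact .plain ‹_›
    | exact .insert ‹_› ‹_›
    | exact .keep ‹_›
    | exact .erase ‹_›
    | exact .act ‹_›

theorem TEvent.Fits.rename_mem (h : u.Fits A p) : u.rename ∈ labels (⋃ i, A i) := by
  cases h with
  | plain he => exact Set.mem_iUnion_of_mem _ he
  | insert he hσ => exact Set.mem_iUnion_of_mem _ hσ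
  | keep he => trivial
  | erase he => exact Set.mem_iUnion_of_mem _ he
  | act ha => exact Set.mem_iUnion_of_mem _ ha

theorem TEvent.Fits.erasures_eq (h : u.Fits A p) (k : ℕ) :
    u.erasures k = erasureCount p u.rename k := by
  cases h <;> rfl

end States

variable {E ι : Type*} {XD XF : ι → Type*}

section Steps

variable {T : ∀ i, Automaton (Label E) (TState E (XD i) (XF i))} {i : ι}
  {p q : TState E (XD i) (XF i)}

theorem transformed_tauFree (T : ∀ i, Automaton (Label E) (TState E (XD i) (XF i))) (i : ι) :
    (transformed T i).TauFree := by
  rintro p q (h | ⟨-, -, -, j, -, e, -, h⟩) <;> cases h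

theorem transformed_step_plain {e : E} (h : (transformed T i).step p (some (.plain e)) q) :
    p.IsY ∧ ((T i).step p (some (.ev e)) q ∨ e ∉ observables (T i) ∧ q = p) := by
  rcases h with h | ⟨-, hy, hq, j, -, e, he, h⟩ <;> cases h
  · exact ⟨trivial, .inl ‹_›⟩
  · exact ⟨hy, .inr ⟨he.2, hq⟩⟩

theorem transformed_step_dec {θ : Label E} {e : E}
    (h : (transformed T i).step p (some (.dec θ e)) q) :
    (∃ d f, p = .z d f e) ∧ (T i).step p (some θ) q := by
  rcases h with h | ⟨-, -, -, j, -, e, -, h⟩ <;> cases h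
  exact ⟨⟨_, _, rfl⟩, ‹_›⟩

theorem transformed_step_env {a : WAction E} {e : E}
    (h : (transformed T i).step p (some (.env e a)) q) :
    (∃ d f, p = .w d f a) ∧ (T i).step p (some (.ev e)) q := by
  rcases h with h | ⟨-, -, -, j, -, e, -, h⟩ <;> cases h
  exact ⟨⟨_, _, rfl⟩, ‹_›⟩

end Steps

/-- The largest three-player observers of the components. -/
abbrev localTPOs (Dc : ∀ i, Automaton E (XD i)) (Fc : ∀ i, Automaton E (XF i)) (i : ι) :
    Automaton (Label E) (TState E (XD i) (XF i)) :=
  largestTPO (Dc i) (Fc i)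

variable {Dc : ∀ i, Automaton E (XD i)} {Fc : ∀ i, Automaton E (XF i)} {i j : ι}

section Alphabets

variable {d : XD i} {f : XF i} {e : E}

theorem plain_mem_alphabet_iff :
    .plain e ∈ (transformed (localTPOs Dc Fc) i).alphabet ↔ ∃ j, e ∈ (Fc j).alphabet := by
  constructor
  · rintro ((⟨_, h, hu⟩ | ⟨_, _, _, _, _, _, hu⟩ | ⟨_, _, _, _, _, _, hu⟩) |
      ⟨j, -, _, hj, hu | ⟨_, _, hu | hu | hu⟩⟩) <;> cases hu
    · exact ⟨i, h⟩
    · exact ⟨j, hj.1⟩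
  · rintro ⟨j, hj⟩
    by_cases hi : e ∈ (Fc i).alphabet
    · exact .inl (.inl ⟨e, hi, rfl⟩)
    · exact .inr ⟨j, fun h => hi (h ▸ hj), e, ⟨hj, hi⟩, .inl rfl⟩

theorem dec_mem_alphabet {θ : Label E} (hz : .z d f e ∈ tpoStates (Dc i) (Fc i))
    (hθ : θ ∈ labels (Fc i).alphabet) :
    .dec θ e ∈ (transformed (localTPOs Dc Fc) i).alphabet :=
  .inl (.inr (.inl ⟨θ, hθ, d, f, e, hz, rfl⟩))

theorem dec_mem_alphabet_of_notMem {σ : E} (hi : σ ∈ (Fc i).alphabet) (hi' : e ∉ (Fc i).alphabet)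
    (hj : σ ∈ (Fc j).alphabet) (hj' : e ∈ (Fc j).alphabet) :
    .dec (.ev σ) e ∈ (transformed (localTPOs Dc Fc) i).alphabet :=
  .inr ⟨j, fun h => hi' (h ▸ hj'), e, ⟨hj', hi'⟩, .inr ⟨σ, ⟨hi, hj⟩, .inl rfl⟩⟩

theorem mem_of_dec_mem_alphabet {θ : Label E}
    (h : .dec θ e ∈ (transformed (localTPOs Dc Fc) i).alphabet) :
    θ ∈ labels (Fc i).alphabet ∧ ((∀ σ, θ ≠ .ev σ) → e ∈ (Fc i).alphabet) := by
  rcases h with (⟨_, _, hu⟩ | ⟨_, hθ, _, _, _, hz, hu⟩ | ⟨_, _, _, _, _, _, hu⟩) |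
    ⟨j, -, _, -, hu | ⟨σ, hσ, hu | hu | hu⟩⟩ <;> cases hu
  · exact ⟨hθ, fun _ => hz.2.2⟩
  · exact ⟨hσ.1, fun h => (h σ rfl).elim⟩

theorem env_mem_alphabet {a : WAction E} (hw : .w d f a ∈ tpoStates (Dc i) (Fc i)) :
    .env a.event a ∈ (transformed (localTPOs Dc Fc) i).alphabet :=
  .inl (.inr (.inr ⟨a.event, hw.2.2, d, f, a, hw, rfl⟩))

theorem mem_of_env_mem_alphabet {a : WAction E}
    (h : .env e a ∈ (transformed (localTPOs Dc Fc) i).alphabet) : e ∈ (Fc i).alphabet := by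
  rcases h with (⟨_, _, hu⟩ | ⟨_, _, _, _, _, _, hu⟩ | ⟨_, h, _, _, _, _, hu⟩) |
    ⟨j, -, _, -, hu | ⟨_, h, hu | hu | hu⟩⟩ <;> cases hu
  · exact h
  · exact h.1
  · exact h.1

end Alphabets

section Local

variable {p q : TState E (XD i) (XF i)} {u : TEvent E}

theorem exists_admissible_of_plain {d : XD i} {f : XF i} {e : E} (he : e ∈ (Fc j).alphabet)
    (hp : .y d f ∈ tpoStates (Dc i) (Fc i))
    (h : (transformed (localTPOs Dc Fc) i).selfLooped.step (.y d f) (some (.plain e)) q) :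
    ∃ q₀, Admissible (Dc i).selfLooped (Fc i).selfLooped (.y d f) (.ev e) q₀ ∧
      q = q₀.restrict (Fc i).alphabet := by
  have h := (selfLooped_step_of_mem (plain_mem_alphabet_iff.2 ⟨j, he⟩)).1 h
  obtain ⟨-, h | ⟨hi, rfl⟩⟩ := transformed_step_plain h
  · cases (largestTPO_step_some_iff.1 h).2.2.2 with
    | yz hf =>
      have hi := (Fc i).step_event hf
      exact ⟨_, .yz ((selfLooped_step_of_mem hi).2 hf), (TState.restrict_z_of_mem hi d f).symm⟩
  · exact ⟨_, .yz ((selfLooped_step_of_notMem hi).2 ⟨hp.2, rfl⟩),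
      (TState.restrict_z_of_notMem hi d f).symm⟩

theorem exists_admissible_of_insert (hA : (Dc i).alphabet = (Fc i).alphabet) {d : XD i} {f : XF i}
    {e σ : E} (he : e ∈ (Fc j).alphabet) (hσ : σ ∈ (Fc j).alphabet) (hd : d ∈ (Dc i).states)
    (hf : f ∈ (Fc i).states)
    (h : (transformed (localTPOs Dc Fc) i).selfLooped.step
      ((TState.z d f e).restrict (Fc i).alphabet) (some (.dec (.ev σ) e)) q) :
    ∃ q₀, Admissible (Dc i).selfLooped (Fc i).selfLooped (.z d f e) (.ev σ) q₀ ∧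
      q = q₀.restrict (Fc i).alphabet := by
  by_cases hσi : σ ∈ (Fc i).alphabet
  · by_cases hei : e ∈ (Fc i).alphabet
    · rw [TState.restrict_z_of_mem hei, selfLooped_step_of_mem
        (dec_mem_alphabet ⟨hd, hf, hei⟩ hσi)] at h
      cases (largestTPO_step_some_iff.1 (transformed_step_dec h).2).2.2.2 with
      | zz hd' =>
        exact ⟨_, .zz ((selfLooped_step_of_mem (hA ▸ hσi)).2 hd'),
          (TState.restrict_z_of_mem hei _ f).symm⟩
    · -- the events added to the alphabet block insertions by components that ignore `e`
      rw [TState.restrict_z_of_notMem hei, selfLooped_step_of_mem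
        (dec_mem_alphabet_of_notMem hσi hei hσ he)] at h
      obtain ⟨⟨_, _, ⟨⟩⟩, -⟩ := transformed_step_dec h
  · obtain ⟨-, rfl⟩ := (selfLooped_step_of_notMem fun h => hσi (mem_of_dec_mem_alphabet h).1).1 h
    exact ⟨_, .zz ((selfLooped_step_of_notMem (hA ▸ hσi)).2 ⟨hd, rfl⟩), rfl⟩

theorem exists_admissible_of_keep (hA : (Dc i).alphabet = (Fc i).alphabet) {d : XD i} {f : XF i}
    {e : E} (hd : d ∈ (Dc i).states) (hf : f ∈ (Fc i).states)
    (h : (transformed (localTPOs Dc Fc) i).selfLooped.step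
      ((TState.z d f e).restrict (Fc i).alphabet) (some (.dec .eps e)) q) :
    ∃ q₀, Admissible (Dc i).selfLooped (Fc i).selfLooped (.z d f e) .eps q₀ ∧
      q = q₀.restrict (Fc i).alphabet := by
  by_cases he : e ∈ (Fc i).alphabet
  · rw [TState.restrict_z_of_mem he, selfLooped_step_of_mem
      (dec_mem_alphabet (θ := .eps) ⟨hd, hf, he⟩ trivial)] at h
    cases (largestTPO_step_some_iff.1 (transformed_step_dec h).2).2.2.2 with
    | zw1 hd' hf' =>
      exact ⟨_, .zw1 ((selfLooped_step_of_mem (hA ▸ he)).2 hd')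
        ((selfLooped_step_of_mem he).2 hf'), (TState.restrict_w_of_mem he d f).symm⟩
  · obtain ⟨-, rfl⟩ := (selfLooped_step_of_notMem fun h =>
      he ((mem_of_dec_mem_alphabet h).2 (by simp))).1 h
    rw [TState.restrict_z_of_notMem he]
    exact ⟨_, .zw1 ((selfLooped_step_of_notMem (hA ▸ he)).2 ⟨hd, rfl⟩)
      ((selfLooped_step_of_notMem he).2 ⟨hf, rfl⟩), (TState.restrict_w_of_notMem he d f).symm⟩

theorem exists_admissible_of_erase {d : XD i} {f : XF i} {e : E} (hd : d ∈ (Dc i).states)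
    (hf : f ∈ (Fc i).states)
    (h : (transformed (localTPOs Dc Fc) i).selfLooped.step
      ((TState.z d f e).restrict (Fc i).alphabet) (some (.dec (.erase e) e)) q) :
    ∃ q₀, Admissible (Dc i).selfLooped (Fc i).selfLooped (.z d f e) (.erase e) q₀ ∧
      q = q₀.restrict (Fc i).alphabet := by
  by_cases he : e ∈ (Fc i).alphabet
  · rw [TState.restrict_z_of_mem he, selfLooped_step_of_mem
      (dec_mem_alphabet ⟨hd, hf, he⟩ he)] at h
    cases (largestTPO_step_some_iff.1 (transformed_step_dec h).2).2.2.2 with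
    | zw2 hf' =>
      exact ⟨_, .zw2 ((selfLooped_step_of_mem he).2 hf'), (TState.restrict_w_of_mem he d f).symm⟩
  · obtain ⟨-, rfl⟩ := (selfLooped_step_of_notMem fun h =>
      he ((mem_of_dec_mem_alphabet h).2 (by simp))).1 h
    rw [TState.restrict_z_of_notMem he]
    exact ⟨_, .zw2 ((selfLooped_step_of_notMem he).2 ⟨hf, rfl⟩),
      (TState.restrict_w_of_notMem he d f).symm⟩

theorem exists_admissible_of_act (hA : (Dc i).alphabet = (Fc i).alphabet) {d : XD i} {f : XF i}
    {a : WAction E} (hd : d ∈ (Dc i).states) (hf : f ∈ (Fc i).states)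
    (h : (transformed (localTPOs Dc Fc) i).selfLooped.step
      ((TState.w d f a).restrict (Fc i).alphabet) (some (.env a.event a)) q) :
    ∃ q₀, Admissible (Dc i).selfLooped (Fc i).selfLooped (.w d f a) (.ev a.event) q₀ ∧
      q = q₀.restrict (Fc i).alphabet := by
  by_cases ha : a.event ∈ (Fc i).alphabet
  · rw [TState.restrict_w_of_mem ha, selfLooped_step_of_mem (env_mem_alphabet ⟨hd, hf, ha⟩)] at h
    have h := (largestTPO_step_some_iff.1 (transformed_step_env h).2).2.2.2
    cases a with
    | keep e =>
      cases h with
      | wy1 hd' hf' =>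
        exact ⟨_, .wy1 ((selfLooped_step_of_mem (hA ▸ ha)).2 hd')
          ((selfLooped_step_of_mem ha).2 hf'), rfl⟩
    | erase e =>
      cases h with
      | wy2 hf' => exact ⟨_, .wy2 ((selfLooped_step_of_mem ha).2 hf'), rfl⟩
  · obtain ⟨-, rfl⟩ := (selfLooped_step_of_notMem fun h => ha (mem_of_env_mem_alphabet h)).1 h
    rw [TState.restrict_w_of_notMem ha]
    have hf' := (selfLooped_step_of_notMem ha).2 ⟨hf, rfl⟩
    cases a with
    | keep e => exact ⟨_, .wy1 ((selfLooped_step_of_notMem (hA ▸ ha)).2 ⟨hd, rfl⟩) hf', rfl⟩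
    | erase e => exact ⟨_, .wy2 hf', rfl⟩

theorem exists_admissible_of_fits (hA : (Dc i).alphabet = (Fc i).alphabet)
    (hp : p ∈ tpoStates (Dc i).selfLooped (Fc i).selfLooped)
    (hu : u.Fits (fun i => (Fc i).alphabet) p)
    (h : (transformed (localTPOs Dc Fc) i).selfLooped.step (p.restrict (Fc i).alphabet)
      (some u) q) :
    ∃ q₀, Admissible (Dc i).selfLooped (Fc i).selfLooped p u.rename q₀ ∧
      q = q₀.restrict (Fc i).alphabet := by
  cases hu with
  | plain he => exact exists_admissible_of_plain he hp h
  | insert he hσ => exact exists_admissible_of_insert hA he hσ hp.1 hp.2.1 h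
  | keep he => exact exists_admissible_of_keep hA hp.1 hp.2.1 h
  | erase he => exact exists_admissible_of_erase hp.1 hp.2.1 h
  | act ha => exact exists_admissible_of_act hA hp.1 hp.2.1 h

end Local

section Global

/-- The states of the components of a system in a state of its three-player observer. -/
noncomputable def components (A : ι → Set E) (p : TState E (∀ i, XD i) (∀ i, XF i)) (i : ι) :
    TState E (XD i) (XF i) :=
  (p.map (· i) (· i)).restrict (A i)

section Inversion

variable {X Y : Type*} {D : Automaton E X} {F : Automaton E Y} {d : X} {f : Y} {e σ : E}
  {a : Label E} {q : TState E X Y}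

theorem admissible_y_iff :
    Admissible D F (.y d f) a q ↔ ∃ e f', a = .ev e ∧ F.step f (some e) f' ∧ q = .z d f e :=
  ⟨fun h => by cases h; exact ⟨_, _, rfl, ‹_›, rfl⟩,
    fun ⟨_, _, ha, hf, hq⟩ => ha ▸ hq ▸ .yz hf⟩

theorem admissible_z_ev_iff :
    Admissible D F (.z d f e) (.ev σ) q ↔ ∃ d', D.step d (some σ) d' ∧ q = .z d' f e :=
  ⟨fun h => by cases h; exact ⟨_, ‹_›, rfl⟩, fun ⟨_, hd, hq⟩ => hq ▸ .zz hd⟩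

theorem admissible_z_eps_iff : Admissible D F (.z d f e) .eps q ↔
    (∃ d', D.step d (some e) d') ∧ (∃ f', F.step f (some e) f') ∧ q = .w d f (.keep e) :=
  ⟨fun h => by cases h; exact ⟨⟨_, ‹_›⟩, ⟨_, ‹_›⟩, rfl⟩,
    fun ⟨⟨_, hd⟩, ⟨_, hf⟩, hq⟩ => hq ▸ .zw1 hd hf⟩

theorem admissible_z_erase_iff : Admissible D F (.z d f e) (.erase σ) q ↔
    σ = e ∧ (∃ f', F.step f (some e) f') ∧ q = .w d f (.erase e) :=
  ⟨fun h => by cases h; exact ⟨rfl, ⟨_, ‹_›⟩, rfl⟩,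
    by rintro ⟨rfl, ⟨_, hf⟩, rfl⟩; exact .zw2 hf⟩

theorem admissible_w_keep_iff : Admissible D F (.w d f (.keep e)) a q ↔
    a = .ev e ∧ ∃ d' f', D.step d (some e) d' ∧ F.step f (some e) f' ∧ q = .y d' f' :=
  ⟨fun h => by cases h; exact ⟨rfl, _, _, ‹_›, ‹_›, rfl⟩,
    fun ⟨ha, _, _, hd, hf, hq⟩ => ha ▸ hq ▸ .wy1 hd hf⟩

theorem admissible_w_erase_iff : Admissible D F (.w d f (.erase e)) a q ↔
    a = .ev e ∧ ∃ f', F.step f (some e) f' ∧ q = .y d f' :=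
  ⟨fun h => by cases h; exact ⟨rfl, _, ‹_›, rfl⟩, fun ⟨ha, _, hf, hq⟩ => ha ▸ hq ▸ .wy2 hf⟩

end Inversion

theorem exists_admissible_syncAll (hA : ∀ i, (Dc i).alphabet = (Fc i).alphabet) [Nonempty ι]
    {p : TState E (∀ i, XD i) (∀ i, XF i)} (hp : p ∈ tpoStates (syncAll Dc) (syncAll Fc))
    {a : Label E} (ha : a ∈ labels (syncAll Fc).alphabet) {q : ∀ i, TState E (XD i) (XF i)}
    (h : ∀ i, Admissible (Dc i).selfLooped (Fc i).selfLooped (p.map (· i) (· i)) a (q i)) :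
    ∃ q₀, Admissible (syncAll Dc) (syncAll Fc) p a q₀ ∧ ∀ i, q i = q₀.map (· i) (· i) := by
  have hA : (syncAll Dc).alphabet = (syncAll Fc).alphabet := Set.iUnion_congr hA
  obtain ⟨j⟩ := ‹Nonempty ι›
  rcases p with ⟨d, f⟩ | ⟨d, f, e⟩ | ⟨d, f, e | e⟩ <;> simp only [TState.map] at h
  · obtain ⟨e, -, rfl, -⟩ := admissible_y_iff.1 (h j)
    simp only [admissible_y_iff, Label.ev.injEq] at h
    obtain ⟨f', hf⟩ := exists_syncAll_step (H := Fc) ha fun i => by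
      obtain ⟨_, f', rfl, hf, -⟩ := h i
      exact ⟨f', hf⟩
    exact ⟨_, .yz hf, fun i => by obtain ⟨_, _, rfl, -, hq⟩ := h i; exact hq⟩
  · cases a with
    | ev σ =>
      simp only [admissible_z_ev_iff] at h
      choose d' hd hq using h
      exact ⟨_, .zz (syncAll_step_some_iff.2 ⟨hA ▸ ha, hd⟩), hq⟩
    | eps =>
      simp only [admissible_z_eps_iff] at h
      obtain ⟨d', hd⟩ := exists_syncAll_step (hA ▸ hp.2.2) fun i => (h i).1
      obtain ⟨f', hf⟩ := exists_syncAll_step hp.2.2 fun i => (h i).2.1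
      exact ⟨_, .zw1 hd hf, fun i => (h i).2.2⟩
    | erase σ =>
      simp only [admissible_z_erase_iff] at h
      obtain ⟨f', hf⟩ := exists_syncAll_step hp.2.2 fun i => (h i).2.1
      cases (h j).1
      exact ⟨_, .zw2 hf, fun i => (h i).2.2⟩
  · simp only [admissible_w_keep_iff] at h
    cases (h j).1
    choose d' f' hd hf hq using fun i => (h i).2
    exact ⟨_, .wy1 (syncAll_step_some_iff.2 ⟨hA ▸ ha, hd⟩) (syncAll_step_some_iff.2 ⟨ha, hf⟩), hq⟩
  · simp only [admissible_w_erase_iff] at h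
    cases (h j).1
    choose f' hf hq using fun i => (h i).2
    exact ⟨_, .wy2 (syncAll_step_some_iff.2 ⟨ha, hf⟩), hq⟩

variable {p : TState E (∀ i, XD i) (∀ i, XF i)} {u : TEvent E}

theorem exists_components_eq_map (hp : p ∈ tpoStates (syncAll Dc) (syncAll Fc)) (hy : ¬ p.IsY) :
    ∃ i, components (fun i => (Fc i).alphabet) p i = p.map (· i) (· i) := by
  rcases p with ⟨d, f⟩ | ⟨d, f, e⟩ | ⟨d, f, a⟩
  · exact (hy trivial).elim
  · exact (Set.mem_iUnion.1 hp.2.2).imp fun i hi => TState.restrict_z_of_mem hi _ _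
  · exact (Set.mem_iUnion.1 hp.2.2).imp fun i hi => TState.restrict_w_of_mem hi _ _

theorem isY_of_forall_isY_components (hp : p ∈ tpoStates (syncAll Dc) (syncAll Fc))
    (h : ∀ i, (components (fun i => (Fc i).alphabet) p i).IsY) : p.IsY := by
  by_contra hy
  obtain ⟨i, hi⟩ := exists_components_eq_map hp hy
  have hi := hi ▸ h i
  cases p <;> trivial

theorem fits_of_transformed_step {p q : TState E (XD i) (XF i)}
    (h : (transformed (localTPOs Dc Fc) i).step p (some u) q) :
    u.Fits (fun i => (Fc i).alphabet) p := by
  have hu := (transformed (localTPOs Dc Fc) i).step_event h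
  cases u with
  | plain e =>
    have hy := (transformed_step_plain h).1
    obtain ⟨j, hj⟩ := plain_mem_alphabet_iff.1 hu
    cases p with
    | y => exact .plain hj
    | _ => exact hy.elim
  | dec θ e =>
    obtain ⟨⟨d, f, rfl⟩, h⟩ := transformed_step_dec h
    obtain ⟨⟨-, -, he⟩, -, hθ, h⟩ := largestTPO_step_some_iff.1 h
    cases h with
    | zz => exact .insert he hθ
    | zw1 => exact .keep he
    | zw2 => exact .erase he
  | env e a =>
    obtain ⟨⟨d, f, rfl⟩, h⟩ := transformed_step_env h
    obtain ⟨⟨-, -, ha⟩, -, -, h⟩ := largestTPO_step_some_iff.1 h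
    cases h <;> exact .act ha

theorem fits_of_syncAll_step (hp : p ∈ tpoStates (syncAll Dc) (syncAll Fc))
    {x : ∀ i, TState E (XD i) (XF i)}
    (h : (syncAll (transformed (localTPOs Dc Fc))).step
      (components (fun i => (Fc i).alphabet) p) (some u) x) :
    u.Fits (fun i => (Fc i).alphabet) p := by
  obtain ⟨hu, h⟩ := syncAll_step_some_iff.1 h
  obtain ⟨j, hj⟩ := Set.mem_iUnion.1 hu
  have hfits := fits_of_transformed_step ((selfLooped_step_of_mem hj).1 (h j))
  unfold components at hfits
  obtain hc | hc := TState.restrict_eq_or_isY (Fc j).alphabet (p.map (· j) (· j))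
  · rw [hc] at hfits
    exact TEvent.fits_map_iff.1 hfits
  · generalize (p.map (· j) (· j)).restrict (Fc j).alphabet = y at hfits hc
    cases hfits with
    | plain he =>
      have hy := isY_of_forall_isY_components hp fun i =>
        (transformed_step_plain ((selfLooped_step_of_mem (plain_mem_alphabet_iff.2 ⟨_, he⟩)).1
          (h i))).1
      cases p with
      | y => exact .plain he
      | _ => exact hy.elim
    | _ => exact hc.elim

theorem isSimulation_syncAll_transformed (hA : ∀ i, (Dc i).alphabet = (Fc i).alphabet) :
    IsSimulation TEvent.rename (syncAll (transformed (localTPOs Dc Fc)))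
      (largestTPO (syncAll Dc) (syncAll Fc))
      fun x p => p ∈ tpoStates (syncAll Dc) (syncAll Fc) ∧
        x = components (fun i => (Fc i).alphabet) p where
  mem h := h.1
  init x hx := by
    choose d hd f hf hx using hx
    exact ⟨.y d f, ⟨d, hd, f, hf, rfl⟩,
      ⟨fun i => (Dc i).init_sub (hd i), fun i => (Fc i).init_sub (hf i)⟩, funext hx⟩
  step := by
    rintro _ p ⟨hp, rfl⟩ u x h
    have hu := fits_of_syncAll_step hp h
    obtain ⟨hmem, h⟩ := syncAll_step_some_iff.1 h
    have : Nonempty ι := (Set.mem_iUnion.1 hmem).nonempty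
    choose q hq hx using fun i => exists_admissible_of_fits (hA i) (by
      cases p
      exacts [⟨hp.1 i, hp.2 i⟩, ⟨hp.1 i, hp.2.1 i, trivial⟩, ⟨hp.1 i, hp.2.1 i, trivial⟩])
      (TEvent.fits_map_iff.2 hu) (h i)
    obtain ⟨q', hq', hqq'⟩ := exists_admissible_syncAll hA hp hu.rename_mem hq
    have hq'mem := hq'.mem_tpoStates hp
    exact ⟨q', largestTPO_step_some_iff.2 ⟨hp, hq'mem, hu.rename_mem, hq'⟩, hq'mem,
      funext fun i => (hx i).trans (congrArg _ (hqq' i))⟩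

end Global

/-! ### The modular supervisor -/

section Plant

variable {n k k' : ℕ} {u : TEvent E} {x x' : ∀ i, TState E (XD i) (XF i)}

theorem specification_step (h : (specification n (localTPOs Dc Fc)).step k (some u) k') :
    k ≤ n ∧ k' = u.erasures k := by
  obtain ⟨hk, ⟨_, ⟨i, d, f, e, q, -, rfl⟩, hu, rfl⟩ |
    ⟨_, ⟨i, d, f, e, q, -, rfl⟩ | ⟨i, d, f, e, α, q, -, rfl⟩, hu, rfl⟩⟩ := h <;>
  cases hu <;> exact ⟨hk, rfl⟩

theorem specification_tauFree (n : ℕ) : (specification n (localTPOs Dc Fc)).TauFree := by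
  rintro k k' ⟨-, ⟨u, -, ⟨⟩, -⟩ | ⟨u, -, ⟨⟩, -⟩⟩

theorem specification_alphabet_subset :
    (specification n (localTPOs Dc Fc)).alphabet ⊆
      (syncAll (transformed (localTPOs Dc Fc))).alphabet := by
  rintro _ (⟨i, d, f, e, q, h, rfl⟩ | ⟨i, d, f, e, q, h, rfl⟩ | ⟨i, d, f, e, α, q, h, rfl⟩) <;>
  exact Set.mem_iUnion_of_mem i (dec_mem_alphabet h.1 ((localTPOs Dc Fc i).step_event h))

theorem plain_notMem_specification {e : E} :
    .plain e ∉ (specification n (localTPOs Dc Fc)).alphabet := by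
  rintro (⟨_, _, _, _, _, _, ⟨⟩⟩ | ⟨_, _, _, _, _, _, ⟨⟩⟩ | ⟨_, _, _, _, _, _, _, ⟨⟩⟩)

theorem dec_mem_specification {i : ι} {θ : Label E} {e : E} {p q : TState E (XD i) (XF i)}
    (h : (transformed (localTPOs Dc Fc) i).step p (some (.dec θ e)) q) :
    .dec θ e ∈ (specification n (localTPOs Dc Fc)).alphabet := by
  obtain ⟨⟨d, f, rfl⟩, h⟩ := transformed_step_dec h
  cases (largestTPO_step_some_iff.1 h).2.2.2 with
  | zz => exact .inr (.inr ⟨i, _, _, _, _, _, h, rfl⟩)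
  | zw1 => exact .inr (.inl ⟨i, _, _, _, _, h, rfl⟩)
  | zw2 => exact .inl ⟨i, _, _, _, _, h, rfl⟩

/-- The plant of the modular supervisor: the transformed automata of the components together with
the specification. -/
abbrev modularPlant (n : ℕ) (Dc : ∀ i, Automaton E (XD i)) (Fc : ∀ i, Automaton E (XF i)) :
    Automaton (TEvent E) ((∀ i, TState E (XD i) (XF i)) × ℕ) :=
  (syncAll (transformed (localTPOs Dc Fc))).sync (specification n (localTPOs Dc Fc))

theorem modularPlant_tauFree : (modularPlant n Dc Fc).TauFree :=
  (TauFree.syncAll (transformed_tauFree _)).sync (specification_tauFree n)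

theorem modularPlant_step (h : (modularPlant n Dc Fc).step (x, k) (some u) (x', k')) :
    (syncAll (transformed (localTPOs Dc Fc))).step x (some u) x' ∧ k' = u.erasures k ∧
      (k ≤ n ∨ k' = k) := by
  obtain ⟨hu, hx, hk⟩ := sync_step_some_iff.1 h
  have hu : u ∈ (syncAll (transformed (localTPOs Dc Fc))).alphabet :=
    hu.elim id fun hu => specification_alphabet_subset hu
  have hx := (selfLooped_step_of_mem hu).1 hx
  by_cases hspec : u ∈ (specification n (localTPOs Dc Fc)).alphabet
  · obtain ⟨hkn, hk'⟩ := specification_step ((selfLooped_step_of_mem hspec).1 hk)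
    exact ⟨hx, hk', .inl hkn⟩
  · obtain ⟨-, hk'⟩ := (selfLooped_step_of_notMem hspec).1 hk
    refine ⟨hx, ?_, .inr hk'⟩
    cases u with
    | dec θ e =>
      obtain ⟨j, hj⟩ := Set.mem_iUnion.1 hu
      have := (selfLooped_step_of_mem hj).1 ((syncAll_step_some_iff.1 hx).2 j)
      exact (hspec (dec_mem_specification this)).elim
    | _ => exact hk'

theorem modularPlant_step_plain {e : E} (hk : k ≤ n)
    (h : (syncAll (transformed (localTPOs Dc Fc))).step x (some (.plain e)) x') :
    (modularPlant n Dc Fc).step (x, k) (some (.plain e)) (x', k) :=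
  have he := (syncAll (transformed (localTPOs Dc Fc))).step_event h
  sync_step_some_iff.2 ⟨.inl he, (selfLooped_step_of_mem he).2 h,
    (selfLooped_step_of_notMem plain_notMem_specification).2 ⟨Nat.le_succ_of_le hk, rfl⟩⟩

theorem exists_syncAll_transformed_plain_step {d : ∀ i, XD i} {f f' : ∀ i, XF i} {e : E}
    (hp : .y d f ∈ tpoStates (syncAll Dc) (syncAll Fc)) (h : (syncAll Fc).step f (some e) f') :
    ∃ x, (syncAll (transformed (localTPOs Dc Fc))).step
      (components (fun i => (Fc i).alphabet) (.y d f)) (some (.plain e)) x := by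
  obtain ⟨he, h⟩ := syncAll_step_some_iff.1 h
  obtain ⟨j, hj⟩ := Set.mem_iUnion.1 he
  have hplain i : .plain e ∈ (transformed (localTPOs Dc Fc) i).alphabet :=
    plain_mem_alphabet_iff.2 ⟨j, hj⟩
  refine exists_syncAll_step (Set.mem_iUnion_of_mem j (hplain j)) fun i => ?_
  have hpi : .y (d i) (f i) ∈ tpoStates (Dc i) (Fc i) := ⟨hp.1 i, hp.2 i⟩
  simp only [selfLooped_step_of_mem (hplain i)]
  by_cases hi : e ∈ (Fc i).alphabet
  · have hz : .z (d i) (f i) e ∈ tpoStates (Dc i) (Fc i) := ⟨hp.1 i, hp.2 i, hi⟩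
    exact ⟨_, .inl (.y (largestTPO_step_some_iff.2
      ⟨hpi, hz, hi, .yz ((selfLooped_step_of_mem hi).1 (h i))⟩))⟩
  · exact ⟨_, .inr ⟨hpi, trivial, rfl, j, fun h => hi (h ▸ hj), e, ⟨hj, hi⟩, rfl⟩⟩

end Plant

section Supervisor

variable {YD YF : Type*} {D : Automaton E YD} {F : Automaton E YF}
  {RD : (∀ i, XD i) → YD → Prop} {RF : (∀ i, XF i) → YF → Prop} {n : ℕ}
  {x : (∀ i, TState E (XD i) (XF i)) × ℕ}

theorem modularSupervisor_sub :
    (modularSupervisor n (localTPOs Dc Fc)).Sub (modularPlant n Dc Fc) :=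
  (supCN_isGreatest (TEvent.uncontrollable E) (modularPlant n Dc Fc)).1.1

theorem modularSupervisor_tauFree : (modularSupervisor n (localTPOs Dc Fc)).TauFree :=
  fun _ _ h => modularPlant_tauFree _ _ (modularSupervisor_sub.step _ _ _ h)

theorem modularSupervisor_coreachable (hx : x ∈ (modularSupervisor n (localTPOs Dc Fc)).states) :
    (modularSupervisor n (localTPOs Dc Fc)).Coreachable x :=
  have ⟨_, haccessible, _, hnonblocking⟩ :=
    (supCN_isGreatest (TEvent.uncontrollable E) (modularPlant n Dc Fc)).1
  hnonblocking x hx (haccessible x hx)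

theorem modularSupervisor_plain_step {y : ∀ i, TState E (XD i) (XF i)} {k : ℕ} {e : E}
    (hx : x ∈ (modularSupervisor n (localTPOs Dc Fc)).states)
    (h : (modularPlant n Dc Fc).step x (some (.plain e)) (y, k)) :
    (modularSupervisor n (localTPOs Dc Fc)).step x (some (.plain e)) (y, k) :=
  have ⟨_, _, hcontrollable, _⟩ :=
    (supCN_isGreatest (TEvent.uncontrollable E) (modularPlant n Dc Fc)).1
  hcontrollable x hx _ ((modularPlant n Dc Fc).step_right h) _ trivial h

theorem forall_isY_of_mem_marked (hx : x ∈ (modularSupervisor n (localTPOs Dc Fc)).marked) (i : ι) :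
    (x.1 i).IsY :=
  ((modularSupervisor_sub.marked hx).1 i).2

-- A count above `n` never changes again, and the count of a marked state is at most `n`.
theorem modularSupervisor_count_le (hx : x ∈ (modularSupervisor n (localTPOs Dc Fc)).states) :
    x.2 ≤ n := by
  obtain ⟨y, hy, t, p⟩ := modularSupervisor_coreachable hx
  have hyn : y.2 ≤ n := (modularSupervisor_sub.marked hy).2
  clear hy hx
  induction p with
  | nil => exact hyn
  | @cons _ _ _ l _ h _ ih =>
    cases l with
    | none => exact (modularSupervisor_tauFree _ _ h).elim
    | some u =>
      obtain ⟨-, -, hk | hk⟩ := modularPlant_step (modularSupervisor_sub.step _ _ _ h)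
      · exact hk
      · exact hk ▸ ih hyn

theorem isSimulation_modularSupervisor (hA : ∀ i, (Dc i).alphabet = (Fc i).alphabet) (n : ℕ) :
    IsSimulation TEvent.rename (modularSupervisor n (localTPOs Dc Fc))
      (constrained n (largestTPO (syncAll Dc) (syncAll Fc)))
      fun x p => x ∈ (modularSupervisor n (localTPOs Dc Fc)).states ∧
        p.1 ∈ tpoStates (syncAll Dc) (syncAll Fc) ∧
        x = (components (fun i => (Fc i).alphabet) p.1, p.2) where
  mem := by
    rintro _ p ⟨hx, hp, rfl⟩
    exact ⟨hp, modularSupervisor_count_le hx⟩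
  init := by
    rintro ⟨x, k⟩ hx
    obtain ⟨hx', hk⟩ := modularSupervisor_sub.init hx
    obtain ⟨p, hp, hm, rfl⟩ := (isSimulation_syncAll_transformed hA).init x hx'
    exact ⟨(p, k), ⟨hp, hk⟩, (modularSupervisor _ _).init_sub hx, hm, rfl⟩
  step := by
    rintro _ ⟨p, k⟩ ⟨hx, hp, rfl⟩ u ⟨x', k'⟩ h
    have hx' := (modularSupervisor _ _).step_right h
    obtain ⟨hs, rfl, -⟩ := modularPlant_step (modularSupervisor_sub.step _ _ _ h)
    obtain ⟨q, hq, hm, rfl⟩ := (isSimulation_syncAll_transformed hA).step ⟨hp, rfl⟩ hs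
    exact ⟨(q, u.erasures k), ⟨hq, modularSupervisor_count_le hx, modularSupervisor_count_le hx',
      _, rfl, (fits_of_syncAll_step hp hs).erasures_eq k⟩, hx', hm, rfl⟩

theorem exists_modularSupervisor_plain_step {d : ∀ i, XD i} {f f' : ∀ i, XF i} {k : ℕ} {e : E}
    (hp : .y d f ∈ tpoStates (syncAll Dc) (syncAll Fc))
    (hx : (components (fun i => (Fc i).alphabet) (.y d f), k) ∈
      (modularSupervisor n (localTPOs Dc Fc)).states)
    (h : (syncAll Fc).step f (some e) f') :
    ∃ x', (modularSupervisor n (localTPOs Dc Fc)).step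
      (components (fun i => (Fc i).alphabet) (.y d f), k) (some (.plain e)) x' := by
  obtain ⟨y, hy⟩ := exists_syncAll_transformed_plain_step hp h
  exact ⟨_, modularSupervisor_plain_step hx
    (modularPlant_step_plain (modularSupervisor_count_le hx) hy)⟩

theorem exists_isEditSupervisor (hsimD : IsSimulation id (syncAll Dc) D RD)
    (hsimF : IsSimulation id (syncAll Fc) F RF) (hA : ∀ i, (Dc i).alphabet = (Fc i).alphabet)
    (hAF : (syncAll Fc).alphabet = F.alphabet) (hF : F.IsDeterministic)
    (hen : ∀ {b f e f'}, RF b f → F.step f (some e) f' → ∃ b', (syncAll Fc).step b (some e) b')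
    (n : ℕ) :
    ∃ R, IsEditSupervisor n D F TEvent.rename (modularSupervisor n (localTPOs Dc Fc)) R := by
  refine ⟨_, hF, modularSupervisor_tauFree,
    ((hsimD.largestTPO hsimF hAF).constrained (fun _ _ a k h => erasureCount_eq_of_lift h.2 a k)
      n).comp (isSimulation_modularSupervisor hA n),
    fun x => modularSupervisor_coreachable, ?_, ?_⟩
  · rintro _ ⟨p', k'⟩ hx ⟨⟨p, k⟩, ⟨-, hp, rfl⟩, ⟨-, hpp'⟩, -⟩
    have hy := isY_of_forall_isY_components hp (forall_isY_of_mem_marked hx)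
    cases hpp' <;> exact hy
  · rintro _ d f k e f' hx ⟨⟨p, k⟩, ⟨-, hp, rfl⟩, ⟨-, hpp'⟩, -⟩ hf
    cases hpp' with | y rd rf =>
    obtain ⟨b', hb'⟩ := hen rf hf
    obtain ⟨x', hx'⟩ := exists_modularSupervisor_plain_step hp hx hb'
    exact ⟨_, x', rfl, hx'⟩

end Supervisor

end Transformed

/-! ### Soundness -/

section Soundness

open Automaton

variable {E ι : Type*} {Q : ι → Type*} {G : ∀ i, Automaton E (Q i)} {S : ∀ i, Set (Q i)}
  {r : ∀ i, Setoid (Q i)} {ro rb : ∀ i, Setoid (Set (Quotient (r i)))} {n : ℕ}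

theorem UR_init_nonempty_of_mem_init_modularSupervisor (hr : ∀ i, (G i).IsObsEquiv (r i))
    {x : (∀ i, TState E (Quotient (ro i)) (Quotient (rb i))) × ℕ}
    (hx : x ∈ (modularSupervisor n
      fun i => abstractTPO (G i) (S i) (r i) (ro i) (rb i)).init) (i : ι) :
    ((G i).UR (G i).init).Nonempty := by
  obtain ⟨c, ⟨⟨_, rfl, rfl⟩, hc⟩, -⟩ := (modularSupervisor_sub.init hx).1 i
  by_contra h
  refine hc ⟨_, ⟨UR_init_mem_observer _, ?_⟩, rfl⟩
  rw [(hr i).UR_init_quot, Set.not_nonempty_iff_eq_empty.1 h, Set.image_empty]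
  exact Set.empty_subset _

theorem exists_isEditSupervisor_abstractTPO [Finite ι] (hr : ∀ i, (G i).IsObsEquiv (r i))
    (hro : ∀ i, ((G i).quot (r i)).observer.IsBisimulation (ro i))
    (hrb : ∀ i, ((G i).quot (r i)).observer.IsBisimulation (rb i))
    (hne : ∀ i, ((G i).UR (G i).init).Nonempty) (S : ∀ i, Set (Q i)) (n : ℕ) :
    ∃ R, IsEditSupervisor n ((syncAll G).observer.desired {X | X ⊆ modularSecret S})
      (syncAll G).observer TEvent.rename
      (modularSupervisor n fun i => abstractTPO (G i) (S i) (r i) (ro i) (rb i)) R :=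
  have ⟨_, hdesired⟩ := exists_isSimulation_desired hr hro hne S
  exists_isEditSupervisor hdesired (isSimulation_observer hr hrb hne) (fun _ => rfl) rfl
    (observer_isDeterministic _) (fun h hs => h.exists_step hr hs) n

theorem observer_syncAll_lang [Finite ι] (hne : ∀ i, ((G i).UR (G i).init).Nonempty) :
    (syncAll G).observer.lang = (syncAll G).lang := by
  refine observer_lang ?_
  rw [syncAll_init, UR_syncAll fun i => (G i).init_sub]
  exact Set.univ_pi_nonempty_iff.2 hne

end Soundness

theorem mainTheorem1_general {E ι : Type*} [Finite ι] {Q : ι → Type*}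
    (G : ∀ i, Automaton E (Q i)) (S : ∀ i, Set (Q i)) (n : ℕ)
    (r : ∀ i, Setoid (Q i)) (hr : ∀ i, (G i).IsObsEquiv (r i))
    (ro : ∀ i, Setoid (Set (Quotient (r i))))
    (hro : ∀ i, ((G i).quot (r i)).observer.IsBisimulation (ro i))
    (rb : ∀ i, Setoid (Set (Quotient (r i))))
    (hrb : ∀ i, ((G i).quot (r i)).observer.IsBisimulation (rb i))
    (L : Set (List E)) (hL : L = (Automaton.syncAll G).lang)
    (AES : Automaton (Label E) (TState E (Set (∀ i, Q i)) (Set (∀ i, Q i)) × ℕ))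
    (hAES : AES = systemAES n (Automaton.syncAll G) (modularSecret S))
    (Sup : Automaton (TEvent E) ((∀ i, TState E (Quotient (ro i)) (Quotient (rb i))) × ℕ))
    (hSup : Sup = modularSupervisor n fun i => abstractTPO (G i) (S i) (r i) (ro i) (rb i)) :
    (∀ t ∈ Sup.markedLang, ∃ ω, runWord ω = t.map TEvent.rename) ∧
    (∀ t ∈ Sup.lang, ∀ ω, runWord ω = t.map TEvent.rename →
      HasRun AES ω ∧ editProj ω ∈ L ∧
        ∃ f : EditFunction E, f.EmbeddedIn L AES ∧ runString ω = f.output (editProj ω)) ∧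
    (∀ f : EditFunction E,
      (∀ s ∈ L, ∃ t ∈ Sup.lang, ∃ ω, runWord ω = t.map TEvent.rename ∧
        editProj ω = s ∧ runString ω = f.output s) →
      f.EmbeddedIn L AES) := by
  subst hL hAES
  have hne {x} (hx : x ∈ Sup.init) :=
    UR_init_nonempty_of_mem_init_modularSupervisor hr (hSup ▸ hx)
  have hedit {x} (hx : x ∈ Sup.init) :=
    hSup ▸ exists_isEditSupervisor_abstractTPO hr hro hrb (hne hx) S n
  have hrun {ω} (hω : IsSupervised TEvent.rename Sup ω) :
      HasRun (systemAES n (Automaton.syncAll G) (modularSecret S)) ω := by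
    obtain ⟨_, ⟨x, hx, -⟩, -⟩ := id hω
    obtain ⟨R, h⟩ := hedit hx
    have := h.hasRun_allEditStructure hω
    rwa [observer_syncAll_lang (hne hx)] at this
  refine ⟨?_, ?_, fun f hf s hs => ?_⟩
  · rintro t ⟨x, hx, ht⟩
    obtain ⟨R, h⟩ := hedit hx
    exact h.exists_runWord_of_mem_markedLang ⟨x, hx, ht⟩
  · intro t ht ω hω
    obtain ⟨x, hx, -⟩ := id ht
    obtain ⟨R, h⟩ := hedit hx
    rw [← observer_syncAll_lang (hne hx)]
    obtain ⟨f, hf, hfω⟩ := h.exists_editFunction ⟨t, ht, hω⟩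
    refine ⟨hrun ⟨t, ht, hω⟩, h.editProj_mem_lang ⟨t, ht, hω⟩, f, fun s hs => ?_, hfω⟩
    obtain ⟨v, hv, hvs, hvf⟩ := hf s hs
    exact ⟨v, hrun hv, hvs, hvf⟩
  · obtain ⟨t, ht, ω, hω, hωs, hωf⟩ := hf s hs
    exact ⟨ω, hrun ⟨t, ht, hω⟩, hωs, hωf⟩

theorem mainTheorem1 {E : Type*} {m : ℕ} {Q : Fin m → Type*}
    -- the modular system with its sets of secret states, and the bound `n` of the constraint
    (G : ∀ i, Automaton E (Q i)) (S : ∀ i, Set (Q i)) (hS : ∀ i, S i ⊆ (G i).states) (n : ℕ)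
    -- the abstractions of the components and of their observers
    (r : ∀ i, Setoid (Q i)) (hr : ∀ i, (G i).IsOpaqueObsEquiv (S i) (r i))
    (ro : ∀ i, Setoid (Set (Quotient (r i))))
    (hro : ∀ i, ((G i).quot (r i)).IsOpaqueBisimulation (Quotient.mk (r i) '' S i) (ro i))
    (rb : ∀ i, Setoid (Set (Quotient (r i))))
    (hrb : ∀ i, ((G i).quot (r i)).observer.IsBisimulation (rb i))
    -- the language and the All Edit Structure of the system, and the supervisor
    (L : Set (List E)) (hL : L = (Automaton.syncAll G).lang)
    (AES : Automaton (Label E) (TState E (Set (∀ i, Q i)) (Set (∀ i, Q i)) × ℕ))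
    (hAES : AES = systemAES n (Automaton.syncAll G) (modularSecret S))
    (Sup : Automaton (TEvent E) ((∀ i, TState E (Quotient (ro i)) (Quotient (rb i))) × ℕ))
    (hSup : Sup = modularSupervisor n fun i => abstractTPO (G i) (S i) (r i) (ro i) (rb i)) :
    -- accepted strings are runs up to renaming
    (∀ t ∈ Sup.markedLang, ∃ ω, runWord ω = t.map TEvent.rename) ∧
    -- every string that is a run yields a decision of an edit function embedded in the AES
    (∀ t ∈ Sup.lang, ∀ ω, runWord ω = t.map TEvent.rename →
      HasRun AES ω ∧ editProj ω ∈ L ∧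
        ∃ f : EditFunction E, f.EmbeddedIn L AES ∧ runString ω = f.output (editProj ω)) ∧
    -- every edit function that is realized by the supervisor is embedded in the AES
    (∀ f : EditFunction E,
      (∀ s ∈ L, ∃ t ∈ Sup.lang, ∃ ω, runWord ω = t.map TEvent.rename ∧
        editProj ω = s ∧ runString ω = f.output s) →
      f.EmbeddedIn L AES) := by
  exact mainTheorem1_general G S n r (fun i => (hr i).isObsEquiv) ro
    (fun i => (hro i).isBisimulation) rb hrb L hL AES hAES Sup hSup
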